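/- Let $k,\ell,m,n$ be nonnegative integers with $n=k+\ell+m\ge 1$ and $m$ even, and let $\operatorname{Gr}(r,n)$ denote the Grassmannian of $r$-dimensional subspaces of $\mathbb{R}^n$. *Stacked twist map.* Let $V$ be a $k\times n$ and $W$ an $\ell\times n$ real matrix, and let $U$ be the $(k+\ell)\times n$ matrix obtained by stacking $V$ on top of $W$, with columns $U(1),\dots,U(n)$ extended to all $j\in\mathbb{Z}$ by $U(j+n)=(-1)^{k-1}U(j)$. Suppose that for every $j\in\mathbb{Z}$ the vectors $U(j-\ell),U(j-\ell+1),\dots,U(j+k-1)$ form a basis of $\mathbb{R}^{k+\ell}$. Let $\tilde U$ be the $(k+\ell)\times n$ matrix whose $j$-th column $\tilde u(j)$ is determined by \[\langle\tilde u(j),U(j-\ell)\rangle=(-1)^j,\qquad \langle\tilde u(j),U(j-\ell+1)\rangle=\dots=\langle\tilde u(j),U(j+k-1)\rangle=0\] (no condition if $k+\ell=0$), let $\tilde W$ consist of the first $k$ rows of $\tilde U$ and $\tilde V$ of its last $\ell$ rows. The row spans of $\tilde W$ and $\tilde V$ depend only on the row spans of $V$ and $W$, and the stacked twist map \[\theta:\operatorname{Gr}(k,n)\times\operatorname{Gr}(\ell,n)\dashrightarrow\operatorname{Gr}(k,n)\times\operatorname{Gr}(\ell,n)\]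 sends $(\operatorname{rowspan}V,\operatorname{rowspan}W)$ to $(\operatorname{rowspan}\tilde W,\operatorname{rowspan}\tilde V)$. *Canonical form.* For $0\le r\le n$, the canonical form $\omega_{r,n}$ is the rational top form on $\operatorname{Gr}(r,n)$ which, at the row span of $X=[\operatorname{Id}_r\mid A]$ with $A=(a_{i,j})$ an $r\times(n-r)$ matrix, equals \[\omega_{r,n}=\pm\frac{da_{1,1}\wedge da_{1,2}\wedge\dots\wedge da_{r,n-r}}{\prod_{i=1}^n\Delta_{\{i,i+1,\dots,i+r-1\}}(X)},\] where $\Delta_I(X)$ is the maximal minor of $X$ with column set $I$, and the indices are taken modulo $n$. It is defined up to a sign, and it is regular on the locus $\operatorname{Gr}^\circ(r,n)$ of subspaces all of whose circular minors $\Delta_{\{i,\dots,i+r-1\}}$ are nonzero; this locus is contained in the chart $A\mapsto\operatorname{rowspan}[\operatorname{Id}_r\mid A]$. **Theorem.** The stacked twist map preserves the top form $\omega_{k,n}\wedge\omega_{\ell,n}$ on $\operatorname{Gr}(k,n)\times\operatorname{Gr}(\ell,n)$ up to a sign: \[\theta^*(\omega_{k,n}\wedge\omega_{\ell,n})=\pm\,\omega_{k,n}\wedge\omega_{\ell,n}.\]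 More precisely, let $D$ be the set of the points of $\operatorname{Gr}^\circ(k,n)\times\operatorname{Gr}^\circ(\ell,n)$ at which $\theta$ is defined. In the coordinates $(A,B)\mapsto(\operatorname{rowspan}[\operatorname{Id}_k\mid A],\operatorname{rowspan}[\operatorname{Id}_\ell\mid B])$ the set $D$ is open and dense, $\theta$ maps $D$ into $\operatorname{Gr}^\circ(k,n)\times\operatorname{Gr}^\circ(\ell,n)$, it is differentiable at every point of $D$, and the displayed equality holds at all points of $D$, with one and the same sign. -/

import Mathlib

noncomputable section

namespace StackedTwist

open scoped Matrix

/-! ### Grassmannian and row spans -/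

/-- The real Grassmannian of `k`-dimensional subspaces of `ℝⁿ`. -/
abbrev Gr (k n : ℕ) : Type :=
  {X : Submodule ℝ (Fin n → ℝ) // Module.finrank ℝ X = k}

/-- The row span of a matrix with `n` columns. -/
def rowSpan {ι : Type} {n : ℕ} (V : Matrix ι (Fin n) ℝ) : Submodule ℝ (Fin n → ℝ) :=
  Submodule.span ℝ (Set.range V.row)

/-! ### Columns indexed by the integers -/

/-- The columns `X(1), …, X(n)` of a matrix (`X(j)` is the Lean column of index `j - 1`),
extended to all `j : ℤ` by the rule `X(j + n) = (-1) ^ (s - 1) X(j)`. -/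
def colExt (s : ℕ) {ι : Type} {n : ℕ} [NeZero n] (X : Matrix ι (Fin n) ℝ) (j : ℤ) : ι → ℝ :=
  fun i => (-1 : ℝ) ^ (((s : ℤ) - 1) * ((j - 1) / (n : ℤ)))
    * X i (Fin.ofNat n ((j - 1) % (n : ℤ)).toNat)

/-- The circular `k × k` minor of a `k × n` matrix with columns `i, i + 1, …, i + k - 1` modulo `n`,
for `i = 1, …, n` (here `i - 1 : Fin n`). Thanks to the sign in `colExt k`, this is
the minor in which the columns are taken in increasing order modulo `n`. -/
def circMinor {k n : ℕ} [NeZero n] (X : Matrix (Fin k) (Fin n) ℝ) (i : Fin n) : ℝ :=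
  Matrix.det (Matrix.of fun a b : Fin k => colExt k X ((i : ℤ) + 1 + (b : ℤ)) a)

/-! ### The twist and the stacked twist on matrices -/

/-- `stack(V, W)`: the matrix `V` on top of the matrix `W`; the rows are indexed by
`Fin k ⊕ Fin l`. -/
abbrev stack {k l n : ℕ} (V : Matrix (Fin k) (Fin n) ℝ) (W : Matrix (Fin l) (Fin n) ℝ) :
    Matrix (Fin k ⊕ Fin l) (Fin n) ℝ :=
  Matrix.fromRows V W

section Matrices

variable {k l n : ℕ} [NeZero n]

/-- `U ∈ Mat°(k + l, n)`: for every integer `j`, the columns `U(j - l), …, U(j + k - 1)` form a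
basis of `ℝ^(k + l)`, where `U(j + n) = (-1) ^ (k - 1) U(j)`. -/
def InMatCirc (U : Matrix (Fin k ⊕ Fin l) (Fin n) ℝ) : Prop :=
  ∀ j : ℤ,
    LinearIndependent ℝ (fun i : Fin (k + l) => colExt k U (j - (l : ℤ) + (i : ℤ))) ∧
    Submodule.span ℝ (Set.range fun i : Fin (k + l) => colExt k U (j - (l : ℤ) + (i : ℤ))) = ⊤

/-- The conditions that determine the `j`-th column `u` of the twist of `U`:
`⟨u, U(j - l)⟩ = (-1) ^ j` and `⟨u, U(j - l + 1)⟩ = ⋯ = ⟨u, U(j + k - 1)⟩ = 0`. -/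
def IsTwistCol (U : Matrix (Fin k ⊕ Fin l) (Fin n) ℝ) (j : ℤ) (u : Fin k ⊕ Fin l → ℝ) : Prop :=
  ∀ i : Fin (k + l), u ⬝ᵥ colExt k U (j - (l : ℤ) + (i : ℤ)) =
    if (i : ℕ) = 0 then (-1 : ℝ) ^ j else 0

/-- The `j`-th column of the twist of `U`; it is only meaningful for `U ∈ Mat°(k + l, n)`, where
the conditions have exactly one solution (see `existsUnique_isTwistCol`). -/
def twistCol (U : Matrix (Fin k ⊕ Fin l) (Fin n) ℝ) (j : ℤ) : Fin k ⊕ Fin l → ℝ :=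
  Classical.epsilon (IsTwistCol U j)

/-- The twist `τ(U)`, with columns `twistCol U 1, …, twistCol U n`. -/
def twist (U : Matrix (Fin k ⊕ Fin l) (Fin n) ℝ) : Matrix (Fin k ⊕ Fin l) (Fin n) ℝ :=
  Matrix.of fun a j => twistCol U ((j : ℤ) + 1) a

/-- The stacked twist map on pairs of matrices: `τ(stack(V, W))` is cut into its first `k` rows
and its last `l` rows. -/
def stwMat (V : Matrix (Fin k) (Fin n) ℝ) (W : Matrix (Fin l) (Fin n) ℝ) :
    Matrix (Fin k) (Fin n) ℝ × Matrix (Fin l) (Fin n) ℝ :=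
  ((twist (stack V W)).toRows₁, (twist (stack V W)).toRows₂)

/-! ### The stacked twist on pairs of subspaces -/

/-- The pairs of subspaces at which the stacked twist map is defined. -/
def stwDomain (k l n : ℕ) [NeZero n] : Set (Gr k n × Gr l n) :=
  {p | ∀ (V : Matrix (Fin k) (Fin n) ℝ) (W : Matrix (Fin l) (Fin n) ℝ),
    rowSpan V = p.1.1 → rowSpan W = p.2.1 → InMatCirc (stack V W)}

/-- `q` is the image of `p` under the stacked twist map: whatever matrices `V`, `W` represent the
two components of `p`, the two components of `q` are the row spans of the two components of
`stwMat V W`. -/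
def IsStw (p q : Gr k n × Gr l n) : Prop :=
  ∀ (V : Matrix (Fin k) (Fin n) ℝ) (W : Matrix (Fin l) (Fin n) ℝ),
    rowSpan V = p.1.1 → rowSpan W = p.2.1 →
      rowSpan (stwMat V W).1 = q.1.1 ∧ rowSpan (stwMat V W).2 = q.2.1

open Classical in
/-- The stacked twist map `Gr(k, n) × Gr(l, n) ⇢ Gr(k, n) × Gr(l, n)`, a partial map with domain
`stwDomain k l n` (the value outside of the domain is a dummy). -/
def stw (p : Gr k n × Gr l n) : Gr k n × Gr l n :=
  if h : p ∈ stwDomain k l n ∧ ∃ q, IsStw p q then h.2.choose else p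

end Matrices

/-! ### The chart `A ↦ rowspan [Id | A]` -/

/-- The entries of a `k × (n - k)` matrix `A`, with the usual topology. -/
abbrev Coords (k n : ℕ) : Type := Fin k → Fin (n - k) → ℝ

/-- The block matrix `[Id_k | A]`. -/
def chartMatrix {k n : ℕ} (A : Coords k n) : Matrix (Fin k) (Fin n) ℝ :=
  Matrix.of fun i j =>
    if h : (j : ℕ) < k then (if (i : ℕ) = j then 1 else 0)
    else A i ⟨(j : ℕ) - k, by have := j.2; omega⟩

/-- The subspaces all of whose circular minors are nonzero, i.e. those at which the canonical form
has no pole. -/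
def regularLocus (k n : ℕ) [NeZero n] : Set (Gr k n) :=
  {X | ∀ V : Matrix (Fin k) (Fin n) ℝ, rowSpan V = X.1 → ∀ i, circMinor V i ≠ 0}

/-- The coordinates of a subspace `X`: the matrix `A` such that `X` is the row span of
`[Id_k | A]` (a dummy value if there is none). -/
def coord {k n : ℕ} (X : Gr k n) : Coords k n :=
  Classical.epsilon fun A => rowSpan (chartMatrix A) = X.1

/-! ### Proved facts: everything above is well defined -/

section Facts

theorem mem_rowSpan_iff {k n : ℕ} {V : Matrix (Fin k) (Fin n) ℝ} {x : Fin n → ℝ} :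
    x ∈ rowSpan V ↔ ∃ c : Fin k → ℝ, c ᵥ* V = x := by
  rw [rowSpan, ← range_vecMulLinear]
  simp [LinearMap.mem_range]

theorem rowSpan_le_of_mul {k n : ℕ} (g : Matrix (Fin k) (Fin k) ℝ)
    (V : Matrix (Fin k) (Fin n) ℝ) : rowSpan (g * V) ≤ rowSpan V := by
  intro x hx
  obtain ⟨c, rfl⟩ := mem_rowSpan_iff.1 hx
  exact mem_rowSpan_iff.2 ⟨c ᵥ* g, by rw [Matrix.vecMul_vecMul]⟩

theorem rowSpan_mul {k n : ℕ} (g h : Matrix (Fin k) (Fin k) ℝ) (hg : h * g = 1)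
    (V : Matrix (Fin k) (Fin n) ℝ) : rowSpan (g * V) = rowSpan V := by
  refine le_antisymm (rowSpan_le_of_mul g V) ?_
  have := rowSpan_le_of_mul h (g * V)
  rwa [← Matrix.mul_assoc, hg, Matrix.one_mul] at this

theorem linearIndependent_row {k n : ℕ} {X : Gr k n} {V : Matrix (Fin k) (Fin n) ℝ}
    (hV : rowSpan V = X.1) : LinearIndependent ℝ V.row := by
  rw [linearIndependent_iff_card_eq_finrank_span, Set.finrank]
  rw [rowSpan] at hV
  rw [hV, X.2, Fintype.card_fin]

theorem finrank_rowSpan {k n : ℕ} {V : Matrix (Fin k) (Fin n) ℝ}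
    (hV : LinearIndependent ℝ V.row) : Module.finrank ℝ (rowSpan V) = k := by
  rw [rowSpan, finrank_span_eq_card hV, Fintype.card_fin]

/-- Every subspace is the row span of some matrix. -/
theorem exists_rowSpan_eq {k n : ℕ} (X : Gr k n) :
    ∃ V : Matrix (Fin k) (Fin n) ℝ, rowSpan V = X.1 := by
  let b := Module.finBasisOfFinrankEq ℝ X.1 X.2
  refine ⟨Matrix.of fun i => (b i : Fin n → ℝ), ?_⟩
  have h := congrArg (Submodule.map X.1.subtype) b.span_eq
  rw [Submodule.map_span, Submodule.map_top, Submodule.range_subtype, ← Set.range_comp] at h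
  exact h

/-- Two matrices with the same row span differ by an invertible matrix. -/
theorem exists_mul_eq {k n : ℕ} {X : Gr k n} {V V' : Matrix (Fin k) (Fin n) ℝ}
    (hV : rowSpan V = X.1) (hV' : rowSpan V' = X.1) :
    ∃ g h : Matrix (Fin k) (Fin k) ℝ, h * g = 1 ∧ V' = g * V := by
  have key : ∀ A B : Matrix (Fin k) (Fin n) ℝ, rowSpan A = rowSpan B →
      ∃ g : Matrix (Fin k) (Fin k) ℝ, B = g * A := by
    intro A B hAB
    have : ∀ i, ∃ c : Fin k → ℝ, c ᵥ* A = B i := fun i => by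
      apply mem_rowSpan_iff.1
      rw [hAB]
      exact Submodule.subset_span ⟨i, rfl⟩
    choose g hg using this
    refine ⟨Matrix.of g, ?_⟩
    ext i j
    rw [← hg i]
    rfl
  obtain ⟨g, hg⟩ := key V V' (hV.trans hV'.symm)
  obtain ⟨h, hh⟩ := key V' V (hV'.trans hV.symm)
  refine ⟨g, h, ?_, hg⟩
  have h1 : (h * g) * V = (1 : Matrix (Fin k) (Fin k) ℝ) * V := by
    rw [Matrix.mul_assoc, ← hg, ← hh, Matrix.one_mul]
  have hinj := Matrix.vecMul_injective_iff.2 (linearIndependent_row hV)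
  ext i j
  have := hinj (a₁ := (h * g) i) (a₂ := (1 : Matrix (Fin k) (Fin k) ℝ) i) (congrFun h1 i)
  exact congrFun this j

variable {k l n : ℕ} [NeZero n]

theorem isTwistCol_unique {U : Matrix (Fin k ⊕ Fin l) (Fin n) ℝ} (hU : InMatCirc U) {j : ℤ}
    {u v : Fin k ⊕ Fin l → ℝ} (hu : IsTwistCol U j u) (hv : IsTwistCol U j v) : u = v := by
  have h : ∀ x : Fin k ⊕ Fin l → ℝ, u ⬝ᵥ x = v ⬝ᵥ x := by
    intro x
    have hx : x ∈ Submodule.span ℝ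
        (Set.range fun i : Fin (k + l) => colExt k U (j - (l : ℤ) + (i : ℤ))) := by
      rw [(hU j).2]; trivial
    induction hx using Submodule.span_induction with
    | mem x hx => obtain ⟨i, rfl⟩ := hx; exact (hu i).trans (hv i).symm
    | zero => simp
    | add x y _ _ hx hy => rw [dotProduct_add, dotProduct_add, hx, hy]
    | smul a x _ hx => rw [dotProduct_smul, dotProduct_smul, hx]
  ext a
  simpa using h (Pi.single a 1)

/-- On `Mat°(k + l, n)` the columns of the twist exist and are unique. -/
theorem existsUnique_isTwistCol {U : Matrix (Fin k ⊕ Fin l) (Fin n) ℝ} (hU : InMatCirc U)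
    (j : ℤ) : ∃! u, IsTwistCol U j u := by
  refine existsUnique_of_exists_of_unique ?_ fun _ _ => isTwistCol_unique hU
  let b := Module.Basis.mk (hU j).1 (hU j).2.ge
  let f : (Fin k ⊕ Fin l → ℝ) →ₗ[ℝ] ℝ :=
    b.constr ℝ fun i : Fin (k + l) => if (i : ℕ) = 0 then (-1 : ℝ) ^ j else 0
  refine ⟨fun a => f (Pi.single a 1), fun i => ?_⟩
  have hf : ∀ x : Fin k ⊕ Fin l → ℝ, (fun a => f (Pi.single a 1)) ⬝ᵥ x = f x := by
    intro x
    conv_rhs => rw [pi_eq_sum_univ' x, map_sum]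
    simp only [dotProduct, map_smul, smul_eq_mul]
    refine Finset.sum_congr rfl fun a _ => ?_
    rw [mul_comm]
  rw [hf]
  have := b.constr_basis ℝ (fun i : Fin (k + l) => if (i : ℕ) = 0 then (-1 : ℝ) ^ j else 0) i
  rwa [Module.Basis.mk_apply] at this

theorem isTwistCol_twistCol {U : Matrix (Fin k ⊕ Fin l) (Fin n) ℝ} (hU : InMatCirc U) (j : ℤ) :
    IsTwistCol U j (twistCol U j) :=
  Classical.epsilon_spec (existsUnique_isTwistCol hU j).exists

/-- The rows of the twist of a matrix in `Mat°(k + l, n)` are linearly independent. -/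
theorem linearIndependent_row_twist (hkl : k + l ≤ n) {U : Matrix (Fin k ⊕ Fin l) (Fin n) ℝ}
    (hU : InMatCirc U) : LinearIndependent ℝ (twist U).row := by
  rw [← Matrix.vecMul_injective_iff, ← Matrix.coe_vecMulLinear, injective_iff_map_eq_zero]
  intro c hc
  have hc' : ∀ i : Fin (k + l), twistCol U ((i : ℤ) + 1) ⬝ᵥ c = 0 := by
    intro i
    have := congrFun hc ⟨i, lt_of_lt_of_le i.2 hkl⟩
    rw [dotProduct_comm]
    exact this
  let b := Module.Basis.mk (hU 1).1 (hU 1).2.ge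
  have hcb := b.sum_repr c
  have hz : ∀ N : ℕ, ∀ i : Fin (k + l), (i : ℕ) = N → b.repr c i = 0 := by
    intro N
    induction N using Nat.strong_induction_on with
    | _ N ih =>
      intro i hi
      have h0 := hc' i
      rw [← hcb, dotProduct_sum, Finset.sum_eq_single i] at h0
      · have hs := isTwistCol_twistCol hU ((i : ℤ) + 1) ⟨0, by have := i.2; omega⟩
        rw [dotProduct_smul, Module.Basis.mk_apply] at h0
        have he : (1 : ℤ) - l + (i : ℤ) = ((i : ℤ) + 1) - l + ((0 : ℕ) : ℤ) := by push_cast; ring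
        rw [he, hs, if_pos rfl, smul_eq_mul] at h0
        exact (mul_eq_zero.1 h0).resolve_right (zpow_ne_zero _ (by norm_num))
      · intro r _ hr
        rw [dotProduct_smul, Module.Basis.mk_apply]
        rcases lt_or_ge (r : ℕ) (i : ℕ) with hlt | hge
        · rw [ih r (hi ▸ hlt) r rfl, zero_smul]
        · have hne : (r : ℕ) ≠ i := fun h => hr (Fin.ext h)
          have hs := isTwistCol_twistCol hU ((i : ℤ) + 1)
            ⟨(r : ℕ) - i, by have := r.2; omega⟩
          have he : (1 : ℤ) - l + (r : ℤ) = ((i : ℤ) + 1) - l + (((r : ℕ) - i : ℕ) : ℤ) := by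
            push_cast [Nat.cast_sub hge]; ring
          rw [he, hs, if_neg (by simp only; omega), smul_zero]
      · intro h; exact absurd (Finset.mem_univ _) h
  rw [← hcb]
  exact Finset.sum_eq_zero fun i _ => by rw [hz i i rfl, zero_smul]

/-- Row operations on `V` and on `W` act on the stacked twist by the inverse transposes. -/
theorem stwMat_mul (V : Matrix (Fin k) (Fin n) ℝ) (W : Matrix (Fin l) (Fin n) ℝ)
    (g g' : Matrix (Fin k) (Fin k) ℝ) (h h' : Matrix (Fin l) (Fin l) ℝ)
    (hg : g' * g = 1) (hh : h' * h = 1) (hU : InMatCirc (stack V W))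
    (hU' : InMatCirc (stack (g * V) (h * W))) :
    stwMat (g * V) (h * W) = (g'ᵀ * (stwMat V W).1, h'ᵀ * (stwMat V W).2) := by
  have hcol : ∀ j : ℤ, colExt k (stack (g * V) (h * W)) j =
      Sum.elim (g *ᵥ fun a => colExt k (stack V W) j (Sum.inl a))
        (h *ᵥ fun a => colExt k (stack V W) j (Sum.inr a)) := by
    intro j
    ext (a | a)
    all_goals
      simp only [colExt, stack, Matrix.fromRows_apply_inl, Matrix.fromRows_apply_inr,
        Sum.elim_inl, Sum.elim_inr, Matrix.mulVec, dotProduct, Matrix.mul_apply, Finset.mul_sum]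
      exact Finset.sum_congr rfl fun _ _ => by ring
  have key : ∀ j : ℤ, twistCol (stack (g * V) (h * W)) j =
      Sum.elim (g'ᵀ *ᵥ fun a => twistCol (stack V W) j (Sum.inl a))
        (h'ᵀ *ᵥ fun a => twistCol (stack V W) j (Sum.inr a)) := by
    intro j
    refine isTwistCol_unique hU' (isTwistCol_twistCol hU' j) fun i => ?_
    rw [hcol, ← isTwistCol_twistCol hU j i]
    simp only [dotProduct, Fintype.sum_sum_type, Sum.elim_inl, Sum.elim_inr]
    have hadj : ∀ {r : ℕ} (a a' : Matrix (Fin r) (Fin r) ℝ), a' * a = 1 → ∀ x y : Fin r → ℝ,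
        (a'ᵀ *ᵥ x) ⬝ᵥ (a *ᵥ y) = x ⬝ᵥ y := fun a a' ha x y => by
      rw [Matrix.mulVec_transpose, Matrix.dotProduct_mulVec, Matrix.vecMul_vecMul, ha,
        Matrix.vecMul_one]
    exact congrArg₂ (· + ·) (hadj g g' hg _ _) (hadj h h' hh _ _)
  refine Prod.ext ?_ ?_
  · ext a j
    exact congrFun (key ((j : ℤ) + 1)) (Sum.inl a)
  · ext a j
    exact congrFun (key ((j : ℤ) + 1)) (Sum.inr a)

/-- The stacked twist map descends to a map on pairs of subspaces. -/
theorem exists_isStw (hkl : k + l ≤ n) {p : Gr k n × Gr l n} (hp : p ∈ stwDomain k l n) :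
    ∃ q, IsStw p q := by
  obtain ⟨V, hV⟩ := exists_rowSpan_eq p.1
  obtain ⟨W, hW⟩ := exists_rowSpan_eq p.2
  have hU := hp V W hV hW
  have hind := linearIndependent_row_twist hkl hU
  refine ⟨(⟨rowSpan (stwMat V W).1, finrank_rowSpan (hind.comp Sum.inl Sum.inl_injective)⟩,
    ⟨rowSpan (stwMat V W).2, finrank_rowSpan (hind.comp Sum.inr Sum.inr_injective)⟩), ?_⟩
  intro V' W' hV' hW'
  have hU' := hp V' W' hV' hW'
  obtain ⟨g, g', hg, rfl⟩ := exists_mul_eq hV hV'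
  obtain ⟨h, h', hh, rfl⟩ := exists_mul_eq hW hW'
  rw [stwMat_mul V W g g' h h' hg hh hU hU']
  refine ⟨rowSpan_mul _ gᵀ ?_ _, rowSpan_mul _ hᵀ ?_ _⟩
  · rw [← Matrix.transpose_mul, hg, Matrix.transpose_one]
  · rw [← Matrix.transpose_mul, hh, Matrix.transpose_one]

/-- On its domain, the stacked twist map of subspaces is computed by the stacked twist map of
matrices, for any choice of representing matrices. -/
theorem isStw_stw (hkl : k + l ≤ n) {p : Gr k n × Gr l n} (hp : p ∈ stwDomain k l n) :
    IsStw p (stw p) := by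
  have h : p ∈ stwDomain k l n ∧ ∃ q, IsStw p q := ⟨hp, exists_isStw hkl hp⟩
  rw [stw, dif_pos h]
  exact h.2.choose_spec

theorem vecMul_chartMatrix {k n : ℕ} (hk : k ≤ n) (A : Coords k n) (c : Fin k → ℝ) (i : Fin k) :
    (c ᵥ* chartMatrix A) ⟨i, lt_of_lt_of_le i.2 hk⟩ = c i := by
  simp [Matrix.vecMul, dotProduct, chartMatrix, Fin.val_inj]

theorem linearIndependent_row_chartMatrix {k n : ℕ} (hk : k ≤ n) (A : Coords k n) :
    LinearIndependent ℝ (chartMatrix A).row := by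
  rw [← Matrix.vecMul_injective_iff]
  intro c d hcd
  ext i
  rw [← vecMul_chartMatrix hk A c i, ← vecMul_chartMatrix hk A d i]
  exact congrFun hcd _

end Facts

/-- The chart of `Gr(k, n)` sending a `k × (n - k)` matrix `A` to the row span of `[Id_k | A]`. -/
def chart {k n : ℕ} (hk : k ≤ n) (A : Coords k n) : Gr k n :=
  ⟨rowSpan (chartMatrix A), finrank_rowSpan (linearIndependent_row_chartMatrix hk A)⟩

theorem chart_injective {k n : ℕ} (hk : k ≤ n) : Function.Injective (chart (n := n) hk) := by
  intro A B hAB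
  obtain ⟨g, -, -, hg⟩ := exists_mul_eq (X := chart hk A) rfl (congrArg Subtype.val hAB).symm
  have h1 : g = 1 := by
    ext i j
    have h2 := vecMul_chartMatrix hk A (g i) j
    have h3 : (g i ᵥ* chartMatrix A) = (g * chartMatrix A) i := rfl
    rw [h3, ← hg] at h2
    rw [← h2]
    simp [chartMatrix, Matrix.one_apply, Fin.ext_iff]
  rw [h1, Matrix.one_mul] at hg
  ext i j
  have := congrFun (congrFun hg i) ⟨k + j, by have := j.2; omega⟩
  simpa [chartMatrix] using this.symm

/-- `coord` is a left inverse of the chart. -/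
theorem coord_chart {k n : ℕ} (hk : k ≤ n) (A : Coords k n) : coord (chart hk A) = A := by
  apply chart_injective hk
  apply Subtype.ext
  exact Classical.epsilon_spec
    (p := fun B : Coords k n => rowSpan (chartMatrix B) = (chart hk A).1) ⟨A, rfl⟩

/-- The chart covers the locus where all the circular minors are nonzero. -/
theorem chart_coord {k n : ℕ} [NeZero n] (hk : k ≤ n) {X : Gr k n} (hX : X ∈ regularLocus k n) :
    chart hk (coord X) = X := by
  obtain ⟨V, hV⟩ := exists_rowSpan_eq X
  have hdet := hX V hV 0
  set M : Matrix (Fin k) (Fin k) ℝ := V.submatrix id (Fin.castLE hk) with hM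
  have hMd : circMinor V 0 = M.det := by
    rw [circMinor]
    congr 1
    ext a b
    have hb : ((b : ℕ) : ℤ) < n := by have := b.2; omega
    have h1 : ((((0 : Fin n) : ℕ) : ℤ) + 1 + (b : ℤ) - 1) = ((b : ℕ) : ℤ) := by simp
    simp only [Matrix.of_apply, colExt, h1, hM, Matrix.submatrix_apply, id]
    rw [Int.ediv_eq_zero_of_lt (by omega) hb, Int.emod_eq_of_lt (by omega) hb, mul_zero, zpow_zero,
      one_mul, Int.toNat_natCast]
    congr 1
    ext
    simp [Nat.mod_eq_of_lt (lt_of_lt_of_le b.2 hk)]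
  rw [hMd] at hdet
  have hMM : M⁻¹ * M = 1 := Matrix.nonsing_inv_mul _ (isUnit_iff_ne_zero.2 hdet)
  have hMM' : M * M⁻¹ = 1 := Matrix.mul_nonsing_inv _ (isUnit_iff_ne_zero.2 hdet)
  have hex : ∃ A : Coords k n, rowSpan (chartMatrix A) = X.1 := by
    refine ⟨fun i j => (M⁻¹ * V) i ⟨k + j, by have := j.2; omega⟩, ?_⟩
    rw [← hV, ← rowSpan_mul M⁻¹ M hMM' V]
    congr 1
    ext i j
    simp only [chartMatrix, Matrix.of_apply]
    split_ifs with h1 h2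
    · have := congrFun (congrFun hMM i) ⟨j, h1⟩
      rw [Matrix.one_apply, if_pos (Fin.ext h2)] at this
      exact this.symm
    · have := congrFun (congrFun hMM i) ⟨j, h1⟩
      rw [Matrix.one_apply, if_neg (fun h => h2 (congrArg Fin.val h))] at this
      exact this.symm
    · exact congrArg ((M⁻¹ * V) i) (Fin.ext (by simp only; omega))
  exact Subtype.ext (Classical.epsilon_spec hex)

/-! ### Differential forms -/

/-- The exterior product of two alternating forms. The degree of a form is the number of elements
of its index type. -/
def wedge {E ι κ : Type} [AddCommGroup E] [Module ℝ E] [Fintype ι] [Fintype κ]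
    [DecidableEq ι] [DecidableEq κ] (α : E [⋀^ι]→ₗ[ℝ] ℝ) (β : E [⋀^κ]→ₗ[ℝ] ℝ) :
    E [⋀^ι ⊕ κ]→ₗ[ℝ] ℝ :=
  (LinearMap.mul' ℝ ℝ).compAlternatingMap (α.domCoprod β)

/-- The form `dA = da₁₁ ∧ da₁₂ ∧ ⋯` of degree `k (n - k)` in the coordinates `A`, sending
a family of tangent vectors `v` indexed by the pairs `(i, j)` to `det (da_q (v_p))_{p, q}`. -/
def coordVolume (k n : ℕ) : Coords k n [⋀^Fin k × Fin (n - k)]→ₗ[ℝ] ℝ :=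
  Matrix.detRowAlternating.compLinearMap
    (LinearEquiv.curry ℝ ℝ (Fin k) (Fin (n - k))).symm.toLinearMap

/-- The canonical form of `Gr(k, n)` in the coordinates `A`, at the row span of `[Id_k | A]`:
`dA` divided by the product of all the circular minors of `[Id_k | A]`. -/
def canonicalForm (k n : ℕ) [NeZero n] (A : Coords k n) :
    Coords k n [⋀^Fin k × Fin (n - k)]→ₗ[ℝ] ℝ :=
  (∏ i : Fin n, circMinor (chartMatrix A) i)⁻¹ • coordVolume k n

/-- The top form `ω_{k,n} ∧ ω_{l,n}` on `Gr(k, n) × Gr(l, n)`, each factor being pulled back along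
the projection. -/
def topForm (k l n : ℕ) [NeZero n] (p : Coords k n × Coords l n) :
    (Coords k n × Coords l n) [⋀^(Fin k × Fin (n - k)) ⊕ (Fin l × Fin (n - l))]→ₗ[ℝ] ℝ :=
  wedge ((canonicalForm k n p.1).compLinearMap (LinearMap.fst ℝ (Coords k n) (Coords l n)))
    ((canonicalForm l n p.2).compLinearMap (LinearMap.snd ℝ (Coords k n) (Coords l n)))

/-- The pullback `(φ^* ω)(p) = ω(φ(p)) ∘ dφ(p)` of a differential form. -/
def pullback {E ι : Type} [NormedAddCommGroup E] [NormedSpace ℝ E] (φ : E → E)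
    (ω : E → E [⋀^ι]→ₗ[ℝ] ℝ) (p : E) : E [⋀^ι]→ₗ[ℝ] ℝ :=
  (ω (φ p)).compLinearMap (fderiv ℝ φ p).toLinearMap

/-! ### The stacked twist map in coordinates -/

section Coordinates

variable {k l n : ℕ} [NeZero n]

/-- The point of `Gr(k, n) × Gr(l, n)` with the given coordinates. -/
def chartProd (hk : k ≤ n) (hl : l ≤ n) (p : Coords k n × Coords l n) : Gr k n × Gr l n :=
  (chart hk p.1, chart hl p.2)

/-- The stacked twist map read in the coordinates of source and target. -/
def stwCoord (hk : k ≤ n) (hl : l ≤ n) (p : Coords k n × Coords l n) :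
    Coords k n × Coords l n :=
  (coord (stw (chartProd hk hl p)).1, coord (stw (chartProd hk hl p)).2)

/-- The points of `Gr(k, n) × Gr(l, n)` at which the stacked twist map is defined and the form
`ω_{k,n} ∧ ω_{l,n}` has no pole. -/
def goodLocus (k l n : ℕ) [NeZero n] : Set (Gr k n × Gr l n) :=
  stwDomain k l n ∩ (regularLocus k n ×ˢ regularLocus l n)

end Coordinates

end StackedTwist

end

open StackedTwist

noncomputable section

namespace StackedTwist

open scoped Matrix Topology

/-! Let `x(j)` be the extended columns of `stack(V, W)`, `y(j)` the columns of its twist, and `P`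
the product over one period of the determinants of the windows of `k + l` consecutive `x(j)`. The
defining relations say that the Gram matrix of `y(j), y(j+1), …` against `x(j-l), x(j-l+1), …` is
triangular with diagonal entries ±1. Hence a window of `y` and the matching window of `x` have
determinants with product ±1 (`IsTwistPair.windowDet_mul`), and a minor of one half of the twist,
times a window determinant, is ± the complementary minor of the other half of `x`
(`IsTwistPair.minor_mul`). Over a period, with W̃ and Ṽ the two halves of the twist, this gives
circProd W̃ · P = ± circProd W and circProd Ṽ · P = ± circProd V.

For the Jacobian, differentiate the relations: ⟨dy(a), x(b)⟩ = -⟨y(a), dx(b)⟩ for `b` in the window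
of `a`. As a linear map of `dy` the left side has determinant ±P (`det_pairLeft`). As a linear map
of `dx` the right side is, after regrouping the pairs (a, b) by `b`, a product of windows of `y`, so
its determinant is ±1/P (`det_pairRight`, `prod_windowDet_twistCol`). Matrix directions split into
row operations and chart directions. The row operations enter through Z ↦ c⁻¹ Zᵀ c, of determinant
±1, since the twist turns `g` into its inverse transpose. If `c`, `d` are the leading blocks of W̃,
Ṽ and J is the Jacobian determinant in the charts, this leaves P² (det c · det d)ⁿ J = ±1
(`det_pairRight_eq`, `det_fderiv_stwCoord`).

The circular products of W̃ and Ṽ are (det c)ⁿ and (det d)ⁿ times those of the normalized matrices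
[Id | A'], [Id | B']. So the powers of P, det c and det d cancel between the two computations, and J
is ± the ratio of the denominators of the form at the image and at the source.

Openness and density hold because the locus is the nonvanishing set of an analytic function, which
is nonzero at a Vandermonde point. -/

theorem unit_cast_mul_self (ε : ℤˣ) : ((ε : ℤ) : ℝ) * ((ε : ℤ) : ℝ) = 1 := by
  rcases Int.units_eq_one_or ε with h | h <;> simp [h]

/-! ### Windows of consecutive columns -/

section Windows

variable {N : ℕ} {α : Type}

/-- The determinant of the window `x j, …, x (j + N - 1)` of a sequence of vectors, whose
coordinates are enumerated by `e`. -/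
def windowDet (e : Fin N ≃ α) (x : ℤ → α → ℝ) (j : ℤ) : ℝ :=
  (Matrix.of fun i t : Fin N => x (j + (t : ℤ)) (e i)).det

/-- The sign is that of a permutation of rows. As in the later sign lemmas, it is chosen before the
vectors, which is what finally yields one sign valid at all points. -/
theorem windowDet_equiv (e e' : Fin N ≃ α) :
    ∃ ε : ℤˣ, ∀ (x : ℤ → α → ℝ) (j : ℤ),
      windowDet e' x j = ((ε : ℤ) : ℝ) * windowDet e x j := by
  refine ⟨Equiv.Perm.sign (e'.trans e.symm), fun x j => ?_⟩
  rw [windowDet, windowDet, ← Matrix.det_permute]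
  congr 1
  ext i t
  simp

theorem windowDet_of_eq_mul (e : Fin N ≃ α) {x y : ℤ → α → ℝ} {ε : ℤ → ℤˣ}
    (h : ∀ j a, y j a = ((ε j : ℤ) : ℝ) * x j a) (j : ℤ) :
    windowDet e y j = (((∏ t : Fin N, ε (j + (t : ℤ)) : ℤˣ) : ℤ) : ℝ) * windowDet e x j := by
  have h1 := Matrix.det_mul_row (fun t : Fin N => ((ε (j + (t : ℤ)) : ℤ) : ℝ))
    (Matrix.of fun i t : Fin N => x (j + (t : ℤ)) (e i))
  rw [windowDet, windowDet]
  push_cast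
  rw [← h1]
  congr 1
  ext i t
  simp [h]

theorem windowDet_add_period (e : Fin N ≃ α) {x : ℤ → α → ℝ} {n : ℤ} {s : ℤˣ}
    (h : ∀ j a, x (j + n) a = ((s : ℤ) : ℝ) * x j a) (j : ℤ) :
    windowDet e x (j + n) = (((s ^ N : ℤˣ) : ℤ) : ℝ) * windowDet e x j := by
  have := windowDet_of_eq_mul e (x := x) (y := fun j => x (j + n)) (ε := fun _ => s) h j
  rw [Finset.prod_const, Finset.card_univ, Fintype.card_fin] at this
  rw [← this, windowDet, windowDet]
  congr 1
  ext i t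
  simp only [Matrix.of_apply]
  congr 1
  ring

/-- A shift by one trades the factor at `c` for the factor at `c + n`, which costs one `s`;
iterating gives a sign that does not depend on `g`. -/
theorem prod_shift (n : ℕ) (s : ℤˣ) (c : ℤ) : ∃ ε : ℤˣ, ∀ g : ℤ → ℝ,
    (∀ j, g (j + n) = ((s : ℤ) : ℝ) * g j) →
      ∏ i : Fin n, g ((i : ℤ) + c) = ((ε : ℤ) : ℝ) * ∏ i : Fin n, g (i : ℤ) := by
  rcases Nat.eq_zero_or_pos n with rfl | hn
  · exact ⟨1, fun g _ => by simp⟩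
  obtain ⟨m, rfl⟩ : ∃ m, n = m + 1 := ⟨n - 1, by omega⟩
  have step : ∀ g : ℤ → ℝ, (∀ j, g (j + (m + 1 : ℕ)) = ((s : ℤ) : ℝ) * g j) → ∀ c : ℤ,
      ∏ i : Fin (m + 1), g ((i : ℤ) + (c + 1)) =
        ((s : ℤ) : ℝ) * ∏ i : Fin (m + 1), g ((i : ℤ) + c) := by
    intro g hg c
    rw [Fin.prod_univ_castSucc, Fin.prod_univ_succ]
    have h1 : g (((Fin.last m : Fin (m + 1)) : ℕ) + (c + 1)) = ((s : ℤ) : ℝ) * g c := by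
      rw [← hg]; congr 1; push_cast [Fin.val_last]; ring
    rw [h1]
    simp only [Fin.val_castSucc, Fin.val_succ, Fin.val_zero]
    have h2 : ∀ i : Fin m, g (((i : ℕ) : ℤ) + (c + 1)) = g ((((i : ℕ) + 1 : ℕ) : ℤ) + c) :=
      fun i => by congr 1; push_cast; ring
    rw [Finset.prod_congr rfl fun i _ => h2 i]
    simp only [Nat.cast_zero, zero_add]
    ring
  have hs := unit_cast_mul_self s
  induction c using Int.induction_on with
  | zero => exact ⟨1, fun g _ => by simp⟩
  | succ c ih =>
    obtain ⟨ε, h⟩ := ih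
    refine ⟨s * ε, fun g hg => ?_⟩
    rw [step g hg, h g hg]; push_cast; ring
  -- Since `s` is its own inverse, the forward step can be solved for the product at the smaller
  -- shift.
  | pred c ih =>
    obtain ⟨ε, h⟩ := ih
    refine ⟨s * ε, fun g hg => ?_⟩
    have h1 := step g hg (-(c : ℤ) - 1)
    rw [sub_add_cancel, h g hg] at h1
    push_cast
    rw [mul_assoc, h1, ← mul_assoc, hs, one_mul]

/-- `y` is the twist of the sequence `x` for windows of `N` vectors starting at distance `d` to
the left. -/
def IsTwistPair [Fintype α] (N : ℕ) (d : ℤ) (x y : ℤ → α → ℝ) : Prop :=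
  ∀ (a : ℤ) (t : ℕ), t < N → y a ⬝ᵥ x (a - d + t) = if t = 0 then (-1 : ℝ) ^ a else 0

/-- The sign `∏_{s < N} (-1) ^ (j + s)`. -/
def windowSign (N : ℕ) (j : ℤ) : ℤˣ := ∏ s : Fin N, Int.negOnePow (j + (s : ℤ))

theorem det_lowerTriangular_window {p : ℕ} (L : Matrix (Fin p) (Fin p) ℝ) (j : ℤ)
    (h : ∀ s t : Fin p, s ≤ t → L s t = if s = t then (-1 : ℝ) ^ (j + (s : ℤ)) else 0) :
    L.det = ((windowSign p j : ℤ) : ℝ) := by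
  rw [Matrix.det_of_isLowerTriangular]
  · rw [windowSign]
    push_cast
    refine Finset.prod_congr rfl fun s _ => ?_
    rw [h s s le_rfl, if_pos rfl, Int.cast_negOnePow]
  · intro s t hst
    have hst' : s < t := hst
    rw [h s t hst'.le, if_neg hst'.ne]

/-- This is the relation of index `t - s` for `y (j + s)`. Nothing is known for `t < s`, so Gram
matrices are only triangular. -/
theorem IsTwistPair.dotProduct_eq [Fintype α] {d : ℤ} {x y : ℤ → α → ℝ} (h : IsTwistPair N d x y)
    (j : ℤ) {s t : ℕ} (hst : s ≤ t) (ht : t < N) :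
    y (j + s) ⬝ᵥ x (j - d + t) = if s = t then (-1 : ℝ) ^ (j + (s : ℤ)) else 0 := by
  have h1 := h (j + s) (t - s) (by omega)
  have h2 : j + (s : ℤ) - d + ((t - s : ℕ) : ℤ) = j - d + t := by
    push_cast [Nat.cast_sub hst]; ring
  rw [h2] at h1
  rw [h1]
  congr 1
  simp only [eq_iff_iff]
  omega

/-- The product of the two window matrices is the triangular Gram matrix, with diagonal entries
`(-1) ^ (j + s)`. -/
theorem IsTwistPair.windowDet_mul [Fintype α] (e : Fin N ≃ α) {d : ℤ} {x y : ℤ → α → ℝ}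
    (h : IsTwistPair N d x y) (j : ℤ) :
    windowDet e y j * windowDet e x (j - d) = ((windowSign N j : ℤ) : ℝ) := by
  rw [windowDet, ← Matrix.det_transpose, windowDet, ← Matrix.det_mul]
  refine det_lowerTriangular_window _ j fun s t hst => ?_
  have h1 := h.dotProduct_eq j (s := s) (t := t) hst t.2
  simp only [Fin.val_inj] at h1
  rw [← h1, Matrix.mul_apply, dotProduct, ← e.sum_comp]
  rfl

/-- Complementary minors of a twist pair. -/
theorem IsTwistPair.minor_mul {p q : ℕ} (e : Fin N ≃ Fin p ⊕ Fin q) :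
    ∃ ε : ℤ → ℤˣ, ∀ (d : ℤ) (x y : ℤ → Fin p ⊕ Fin q → ℝ), IsTwistPair N d x y → ∀ j : ℤ,
      windowDet (Equiv.refl (Fin p)) (fun a r => y a (Sum.inl r)) j * windowDet e x (j - d) =
        ((ε j : ℤ) : ℝ) *
          windowDet (Equiv.refl (Fin q)) (fun a r => x a (Sum.inr r)) (j - d + p) := by
  have hN : N = p + q := by
    have := Fintype.card_congr e
    simpa using this
  subst hN
  obtain ⟨δ, hδ⟩ := windowDet_equiv finSumFinEquiv.symm e
  refine ⟨fun j => δ * windowSign p j, fun d x y h j => ?_⟩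
  rw [hδ]
  set Y : Matrix (Fin p) (Fin p) ℝ := Matrix.of fun s r => y (j + (s : ℤ)) (Sum.inl r) with hY
  set Y' : Matrix (Fin p) (Fin q) ℝ := Matrix.of fun s r => y (j + (s : ℤ)) (Sum.inr r) with hY'
  set x' : Fin p ⊕ Fin q → Fin p ⊕ Fin q → ℝ :=
    fun t => x (j - d + ((finSumFinEquiv t : Fin (p + q)) : ℤ)) with hx'
  have h1 : windowDet finSumFinEquiv.symm x (j - d) =
      (Matrix.fromBlocks (Matrix.of fun r t : Fin p => x' (Sum.inl t) (Sum.inl r))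
        (Matrix.of fun (r : Fin p) (t : Fin q) => x' (Sum.inr t) (Sum.inl r))
        (Matrix.of fun (r : Fin q) (t : Fin p) => x' (Sum.inl t) (Sum.inr r))
        (Matrix.of fun r t : Fin q => x' (Sum.inr t) (Sum.inr r))).det := by
    rw [windowDet, ← Matrix.det_submatrix_equiv_self finSumFinEquiv]
    congr 1
    ext (r | r) (t | t) <;> simp [hx']
  -- The `p` vectors `y` are completed to a square matrix by the last `q` coordinate rows.
  -- Multiplying by the window of `x` then keeps the lower rows of that window and turns the upper
  -- rows into pairings.
  have h2 : windowDet (Equiv.refl (Fin p)) (fun a r => y a (Sum.inl r)) j =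
      (Matrix.fromBlocks Y Y' 0 (1 : Matrix (Fin q) (Fin q) ℝ)).det := by
    rw [Matrix.det_fromBlocks_zero₂₁, Matrix.det_one, mul_one, windowDet, ← Matrix.det_transpose]
    rfl
  have h3 : windowDet (Equiv.refl (Fin q)) (fun a r => x a (Sum.inr r)) (j - d + p) =
      (Matrix.of fun r t : Fin q => x' (Sum.inr t) (Sum.inr r)).det := by
    rw [windowDet]
    congr 1
    ext r t
    simp only [Matrix.of_apply, hx', finSumFinEquiv_apply_right, Fin.val_natAdd, Equiv.refl_apply]
    congr 1
    push_cast; ring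
  have key : ∀ (s : Fin p) (t : Fin p ⊕ Fin q),
      ∑ r, Y s r * x' t (Sum.inl r) + ∑ r, Y' s r * x' t (Sum.inr r) =
        y (j + (s : ℤ)) ⬝ᵥ x' t := by
    intro s t
    rw [dotProduct, Fintype.sum_sum_type]
    rfl
  rw [h2, h1, mul_comm, mul_assoc, mul_comm (Matrix.det _) (Matrix.det _), ← Matrix.det_mul,
    Matrix.fromBlocks_multiply, h3]
  -- Window vectors of index at least `p` are orthogonal to `y (j + s)` for `s < p`, so the product
  -- is block lower triangular. Its corner blocks are a triangular Gram matrix and the complementary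
  -- minor.
  have h4 : Y * (Matrix.of fun (r : Fin p) (t : Fin q) => x' (Sum.inr t) (Sum.inl r)) +
      Y' * (Matrix.of fun r t : Fin q => x' (Sum.inr t) (Sum.inr r)) = 0 := by
    ext s t
    refine (key s (Sum.inr t)).trans ?_
    have h5 := h.dotProduct_eq j (s := s) (t := p + t) (by omega) (by omega)
    rw [if_neg (by omega)] at h5
    simpa [hx'] using h5
  rw [h4, Matrix.zero_mul, Matrix.one_mul, zero_add, Matrix.zero_mul, Matrix.one_mul, zero_add,
    Matrix.det_fromBlocks_zero₁₂, det_lowerTriangular_window _ j]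
  · push_cast; ring
  · intro s t hst
    refine (key s (Sum.inl t)).trans ?_
    have h5 := h.dotProduct_eq j (s := s) (t := t) hst (by omega)
    simp only [Fin.val_inj] at h5
    simpa [hx'] using h5

end Windows

/-! ### Quasi-periodic sequences of columns -/

section Columns

theorem windowDet_mulVec {N : ℕ} {α : Type} [Fintype α] [DecidableEq α] (e : Fin N ≃ α)
    (G : Matrix α α ℝ) (x : ℤ → α → ℝ) (j : ℤ) :
    windowDet e (fun j => G *ᵥ x j) j = G.det * windowDet e x j := by
  rw [windowDet, windowDet, ← Matrix.det_submatrix_equiv_self e G, ← Matrix.det_mul]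
  congr 1
  ext i t
  rw [Matrix.mul_apply, Matrix.of_apply, Matrix.mulVec, dotProduct, ← e.sum_comp]
  rfl

theorem prod_windowDet_shift {n N : ℕ} {α : Type} (e : Fin N ≃ α) (s : ℤˣ) (c : ℤ) :
    ∃ ε : ℤˣ, ∀ x : ℤ → α → ℝ, (∀ j a, x (j + n) a = ((s : ℤ) : ℝ) * x j a) →
      ∏ i : Fin n, windowDet e x ((i : ℤ) + c) =
        ((ε : ℤ) : ℝ) * ∏ i : Fin n, windowDet e x (i : ℤ) := by
  obtain ⟨ε, h⟩ := prod_shift n (s ^ N) c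
  exact ⟨ε, fun x hx => h _ (windowDet_add_period e hx)⟩

/-- The column index in `Fin n` of the integer `j`. -/
def colIndex (n : ℕ) [NeZero n] (j : ℤ) : Fin n := Fin.ofNat n ((j - 1) % (n : ℤ)).toNat

variable {n : ℕ} [NeZero n]

theorem val_colIndex (j : ℤ) : (((colIndex n j : Fin n) : ℕ) : ℤ) = (j - 1) % (n : ℤ) := by
  have hn : (0 : ℤ) < n := by exact_mod_cast Nat.pos_of_ne_zero (NeZero.ne n)
  have h0 := Int.emod_nonneg (j - 1) hn.ne'
  have h1 := Int.emod_lt_of_pos (j - 1) hn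
  rw [colIndex, Fin.val_ofNat, Nat.mod_eq_of_lt (by omega), Int.toNat_of_nonneg h0]

theorem eq_colIndex_add (j : ℤ) :
    j = ((colIndex n j : Fin n) : ℕ) + 1 + (n : ℤ) * ((j - 1) / (n : ℤ)) := by
  rw [val_colIndex]
  have := Int.emod_add_mul_ediv (j - 1) n
  omega

theorem colIndex_eq_iff (j : ℤ) (i : Fin n) :
    colIndex n j = i ↔ (n : ℤ) ∣ j - ((i : ℤ) + 1) := by
  have h := eq_colIndex_add (n := n) j
  constructor
  · rintro rfl
    exact ⟨_, by linarith⟩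
  · rintro ⟨c, hc⟩
    have h1 := val_colIndex (n := n) j
    rw [show j - 1 = (i : ℤ) + n * c by linarith, Int.add_mul_emod_self_left,
      Int.emod_eq_of_lt (by omega) (by have := i.2; omega)] at h1
    exact Fin.ext (by exact_mod_cast h1)

theorem eq_pow_mul_of_period {α : Type} {x : ℤ → α → ℝ} {s : ℤˣ}
    (h : ∀ j a, x (j + n) a = ((s : ℤ) : ℝ) * x j a) (j : ℤ) (a : α) :
    x j a = (((s ^ ((j - 1) / (n : ℤ)) : ℤˣ) : ℤ) : ℝ) * x (((colIndex n j : Fin n) : ℕ) + 1) a := by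
  have hs := unit_cast_mul_self s
  have key : ∀ (q i : ℤ), x (i + n * q) a = (((s ^ q : ℤˣ) : ℤ) : ℝ) * x i a := by
    intro q i
    induction q using Int.induction_on with
    | zero => simp
    | succ q ih =>
      rw [show i + (n : ℤ) * ((q : ℤ) + 1) = (i + n * q) + n by ring, h, ih, zpow_add_one]
      push_cast; ring
    | pred q ih =>
      have h1 := h (i + (n : ℤ) * (-(q : ℤ) - 1)) a
      rw [show i + (n : ℤ) * (-(q : ℤ) - 1) + n = i + n * (-(q : ℤ)) by ring, ih] at h1
      rw [zpow_sub_one]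
      have h2 : ((s⁻¹ : ℤˣ)) = s := Int.units_inv_eq_self s
      rw [h2]
      calc x (i + (n : ℤ) * (-(q : ℤ) - 1)) a
          = ((s : ℤ) : ℝ) * (((s : ℤ) : ℝ) * x (i + (n : ℤ) * (-(q : ℤ) - 1)) a) := by
            rw [← mul_assoc, hs, one_mul]
        _ = _ := by rw [← h1]; push_cast; ring
  conv_lhs => rw [eq_colIndex_add (n := n) j]
  exact key _ _

/-- The sign by which the `j`-th extended column differs from an honest column. -/
def colSign (s n : ℕ) (j : ℤ) : ℤˣ := Int.negOnePow (((s : ℤ) - 1) * ((j - 1) / (n : ℤ)))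

theorem colExt_eq (s : ℕ) {ι : Type} (X : Matrix ι (Fin n) ℝ) (j : ℤ) (a : ι) :
    colExt s X j a = ((colSign s n j : ℤ) : ℝ) * X a (colIndex n j) := by
  rw [colSign, Int.cast_negOnePow]
  rfl

/-- The window of a stack extends the lower block by the rule for `k`, while its own circular minors
use the rule for `l`. The discrepancy depends on `j` alone, hence costs only a global sign. -/
theorem colExt_eq_colSign_mul (s s' : ℕ) {ι : Type} (X : Matrix ι (Fin n) ℝ) (j : ℤ) (a : ι) :
    colExt s X j a = ((colSign s n j * colSign s' n j : ℤˣ) : ℤ) * colExt s' X j a := by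
  rw [colExt_eq, colExt_eq]
  have := unit_cast_mul_self (colSign s' n j)
  push_cast
  linear_combination (-((colSign s n j : ℤ) : ℝ) * X a (colIndex n j)) * this

theorem colExt_add_period (s : ℕ) {ι : Type} (X : Matrix ι (Fin n) ℝ) (j : ℤ) (a : ι) :
    colExt s X (j + n) a = ((Int.negOnePow ((s : ℤ) - 1) : ℤ) : ℝ) * colExt s X j a := by
  have hn : (n : ℤ) ≠ 0 := by exact_mod_cast NeZero.ne n
  have h1 : colIndex n (j + n) = colIndex n j := by
    rw [colIndex, colIndex, show j + (n : ℤ) - 1 = j - 1 + n by ring, Int.add_emod_right]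
  rw [colExt_eq, colExt_eq, h1, colSign, colSign, show j + (n : ℤ) - 1 = j - 1 + n by ring,
    Int.add_ediv_of_dvd_right dvd_rfl, Int.ediv_self hn, mul_add, mul_one, Int.negOnePow_add]
  push_cast; ring

theorem circMinor_eq_windowDet {k : ℕ} (X : Matrix (Fin k) (Fin n) ℝ) (i : Fin n) :
    circMinor X i = windowDet (Equiv.refl (Fin k)) (colExt k X) ((i : ℤ) + 1) := rfl

/-- The product of all the circular minors. -/
def circProd {k : ℕ} (X : Matrix (Fin k) (Fin n) ℝ) : ℝ := ∏ i, circMinor X i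

theorem circMinor_mul {k : ℕ} (g : Matrix (Fin k) (Fin k) ℝ) (X : Matrix (Fin k) (Fin n) ℝ)
    (i : Fin n) : circMinor (g * X) i = g.det * circMinor X i := by
  rw [circMinor_eq_windowDet, circMinor_eq_windowDet, ← windowDet_mulVec]
  congr 1
  ext j a
  simp only [colExt_eq, Matrix.mulVec, dotProduct, Matrix.mul_apply, Finset.mul_sum]
  exact Finset.sum_congr rfl fun _ _ => by ring

theorem circProd_mul {k : ℕ} (g : Matrix (Fin k) (Fin k) ℝ) (X : Matrix (Fin k) (Fin n) ℝ) :
    circProd (g * X) = g.det ^ n * circProd X := by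
  simp [circProd, circMinor_mul, Finset.prod_mul_distrib]

theorem circProd_ne_zero_iff {k : ℕ} (X : Matrix (Fin k) (Fin n) ℝ) :
    circProd X ≠ 0 ↔ ∀ i, circMinor X i ≠ 0 := by
  simp [circProd, Finset.prod_ne_zero_iff]

/-- The circular minors of one half of a twist are the complementary circular minors of the other
half of the original matrix, divided by the minors of the windows. -/
theorem circProd_mul_prod_windowDet {N p q : ℕ} (e : Fin N ≃ Fin p ⊕ Fin q) (d : ℤ) (s : ℤˣ)
    (εX εY : ℤ → ℤˣ) : ∃ ε : ℤˣ, ∀ (x y : ℤ → Fin p ⊕ Fin q → ℝ)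
      (X : Matrix (Fin p) (Fin n) ℝ) (Y : Matrix (Fin q) (Fin n) ℝ),
      IsTwistPair N d x y → (∀ j a, x (j + n) a = ((s : ℤ) : ℝ) * x j a) →
      (∀ j a, colExt p X j a = ((εX j : ℤ) : ℝ) * y j (Sum.inl a)) →
      (∀ j a, x j (Sum.inr a) = ((εY j : ℤ) : ℝ) * colExt q Y j a) →
      circProd X * ∏ i : Fin n, windowDet e x (i : ℤ) = ((ε : ℤ) : ℝ) * circProd Y := by
  obtain ⟨ε₁, h₁⟩ := IsTwistPair.minor_mul e
  -- `circMinor X i` starts at column `i + 1`. The window of `x` facing it starts at `i + 1 - d`,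
  -- and the complementary minor `p` columns later; each product is brought back to the start `i`.
  obtain ⟨ε₂, h₂⟩ := prod_windowDet_shift (n := n) e s (1 - d)
  obtain ⟨ε₃, h₃⟩ := prod_windowDet_shift (n := n) (Equiv.refl (Fin q))
    (Int.negOnePow ((q : ℤ) - 1)) (1 - d + p)
  obtain ⟨ε₄, h₄⟩ := prod_windowDet_shift (n := n) (Equiv.refl (Fin q))
    (Int.negOnePow ((q : ℤ) - 1)) 1
  refine ⟨ε₂ * ε₃ * ε₄ * (∏ i : Fin n, ε₁ ((i : ℤ) + 1)) *
    (∏ i : Fin n, ∏ t : Fin p, εX ((i : ℤ) + 1 + (t : ℤ))) *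
    (∏ i : Fin n, ∏ t : Fin q, εY ((i : ℤ) + (1 - d + p) + (t : ℤ))),
    fun x y X Y hxy hx hX hY => ?_⟩
  have hY' := h₃ (colExt q Y) (colExt_add_period q Y)
  have hY'' := h₄ (colExt q Y) (colExt_add_period q Y)
  have hx' := h₂ x hx
  have hterm : ∀ i : Fin n, circMinor X i * windowDet e x ((i : ℤ) + (1 - d)) =
      (((∏ t : Fin p, εX ((i : ℤ) + 1 + (t : ℤ))) * ε₁ ((i : ℤ) + 1) *
        (∏ t : Fin q, εY ((i : ℤ) + (1 - d + p) + (t : ℤ))) : ℤˣ) : ℤ) *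
        windowDet (Equiv.refl (Fin q)) (colExt q Y) ((i : ℤ) + (1 - d + p)) := by
    intro i
    rw [circMinor_eq_windowDet, windowDet_of_eq_mul (Equiv.refl (Fin p)) hX,
      show (i : ℤ) + (1 - d) = (i : ℤ) + 1 - d by ring, mul_assoc, h₁ d x y hxy,
      show (i : ℤ) + 1 - d + p = (i : ℤ) + (1 - d + p) by ring,
      windowDet_of_eq_mul (Equiv.refl (Fin q)) hY]
    push_cast; ring
  have hprod := Finset.prod_congr (rfl : (Finset.univ : Finset (Fin n)) = Finset.univ)
    fun i _ => hterm i
  rw [Finset.prod_mul_distrib, Finset.prod_mul_distrib, hx', hY'] at hprod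
  have hcY : circProd Y = ((ε₄ : ℤ) : ℝ) * ∏ i : Fin n, windowDet (Equiv.refl (Fin q))
      (colExt q Y) (i : ℤ) := hY''
  have hcX : circProd X = ∏ i, circMinor X i := rfl
  rw [← hcX] at hprod
  rw [hcY]
  have e2 := unit_cast_mul_self ε₂
  have e4 := unit_cast_mul_self ε₄
  push_cast at hprod ⊢
  rw [Finset.prod_mul_distrib, Finset.prod_mul_distrib] at hprod
  set P := ∏ i : Fin n, windowDet e x (i : ℤ)
  set Q := ∏ i : Fin n, windowDet (Equiv.refl (Fin q)) (colExt q Y) (i : ℤ)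
  generalize (∏ i : Fin n, ((ε₁ ((i : ℤ) + 1) : ℤ) : ℝ)) = a at hprod ⊢
  generalize (∏ i : Fin n, ∏ t : Fin p, ((εX ((i : ℤ) + 1 + (t : ℤ)) : ℤ) : ℝ)) = b at hprod ⊢
  generalize (∏ i : Fin n, ∏ t : Fin q, ((εY ((i : ℤ) + (1 - d + p) + (t : ℤ)) : ℤ) : ℝ)) = c
    at hprod ⊢
  linear_combination ((ε₂ : ℤ) : ℝ) * hprod - circProd X * P * e2 -
    ((ε₂ : ℤ) : ℝ) * ε₃ * a * b * c * Q * e4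

end Columns

/-! ### The twist as a sequence of columns -/

section Twist

variable {k l n : ℕ} [NeZero n]

theorem inMatCirc_iff (U : Matrix (Fin k ⊕ Fin l) (Fin n) ℝ) :
    InMatCirc U ↔ ∀ j, windowDet finSumFinEquiv.symm (colExt k U) j ≠ 0 := by
  have key : ∀ j : ℤ, (LinearIndependent ℝ (fun i : Fin (k + l) => colExt k U (j + (i : ℤ))) ∧
      Submodule.span ℝ (Set.range fun i : Fin (k + l) => colExt k U (j + (i : ℤ))) = ⊤) ↔
      windowDet finSumFinEquiv.symm (colExt k U) j ≠ 0 := by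
    intro j
    have h1 : (LinearIndependent ℝ (fun i : Fin (k + l) => colExt k U (j + (i : ℤ))) ∧
        Submodule.span ℝ (Set.range fun i : Fin (k + l) => colExt k U (j + (i : ℤ))) = ⊤) ↔
        LinearIndependent ℝ (fun i : Fin (k + l) => colExt k U (j + (i : ℤ))) := by
      refine and_iff_left_of_imp fun h => h.span_eq_top_of_card_eq_finrank' ?_
      simp
    rw [h1, windowDet, ← isUnit_iff_ne_zero, ← Matrix.isUnit_iff_isUnit_det,
      ← Matrix.linearIndependent_cols_iff_isUnit,
      ← LinearMap.linearIndependent_iff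
        (LinearEquiv.funCongrLeft ℝ ℝ (finSumFinEquiv (m := k) (n := l)).symm).toLinearMap
        (LinearEquiv.ker _)]
    rfl
  constructor
  · intro h j
    have := h (j + l)
    rw [add_sub_cancel_right] at this
    exact (key j).1 this
  · intro h j
    exact (key _).2 (h _)

theorem isTwistPair_twistCol {U : Matrix (Fin k ⊕ Fin l) (Fin n) ℝ} (hU : InMatCirc U) :
    IsTwistPair (k + l) l (colExt k U) (twistCol U) := fun a t ht =>
  isTwistCol_twistCol hU a ⟨t, ht⟩

/-- Both sides solve the same linear system: the columns of `U` contribute `(-1) ^ (k - 1)` and the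
right-hand side `(-1) ^ (j + n)` contributes `(-1) ^ n`. -/
theorem twistCol_add_period {U : Matrix (Fin k ⊕ Fin l) (Fin n) ℝ} (hU : InMatCirc U) (j : ℤ)
    (a : Fin k ⊕ Fin l) : twistCol U (j + n) a =
      ((Int.negOnePow ((n : ℤ) + ((k : ℤ) - 1)) : ℤ) : ℝ) * twistCol U j a := by
  suffices h : twistCol U (j + n) =
      ((Int.negOnePow ((n : ℤ) + ((k : ℤ) - 1)) : ℤ) : ℝ) • twistCol U j by
    rw [h]; rfl
  refine isTwistCol_unique hU (isTwistCol_twistCol hU _) fun i => ?_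
  have h1 : colExt k U (j + n - l + (i : ℤ)) =
      ((Int.negOnePow ((k : ℤ) - 1) : ℤ) : ℝ) • colExt k U (j - l + (i : ℤ)) := by
    ext a
    rw [show j + (n : ℤ) - l + (i : ℤ) = j - l + (i : ℤ) + n by ring, colExt_add_period]
    rfl
  rw [h1, dotProduct_smul, smul_dotProduct, isTwistCol_twistCol hU j i, smul_eq_mul, smul_eq_mul,
    Int.negOnePow_add]
  split_ifs
  · rw [zpow_add₀ (by norm_num), ← Int.cast_negOnePow ℝ n]
    push_cast
    linear_combination (-1 : ℝ) ^ j * ((Int.negOnePow (n : ℤ) : ℤ) : ℝ) *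
      unit_cast_mul_self (Int.negOnePow ((k : ℤ) - 1))
  · simp

theorem twistCol_eq {U : Matrix (Fin k ⊕ Fin l) (Fin n) ℝ} (hU : InMatCirc U) (j : ℤ)
    (a : Fin k ⊕ Fin l) : twistCol U j a =
      ((((Int.negOnePow ((n : ℤ) + ((k : ℤ) - 1))) ^ ((j - 1) / (n : ℤ)) : ℤˣ) : ℤ) : ℝ) *
        twist U a (colIndex n j) :=
  eq_pow_mul_of_period (twistCol_add_period hU) j a

/-- The product of the minors of all the windows. -/
def windowProd (U : Matrix (Fin k ⊕ Fin l) (Fin n) ℝ) : ℝ :=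
  ∏ i : Fin n, windowDet finSumFinEquiv.symm (colExt k U) (i : ℤ)

theorem windowProd_ne_zero_iff (U : Matrix (Fin k ⊕ Fin l) (Fin n) ℝ) :
    windowProd U ≠ 0 ↔ InMatCirc U := by
  rw [inMatCirc_iff, windowProd, Finset.prod_ne_zero_iff]
  refine ⟨fun h j => ?_, fun h i _ => h _⟩
  -- Reduction modulo the period lands in `1, …, n`, whereas `windowProd` uses the starts `0, …, n -
  -- 1`; hence the sequence shifted by one.
  have h1 := eq_pow_mul_of_period (n := n) (α := Unit)
    (x := fun j _ => windowDet finSumFinEquiv.symm (colExt k U) (j - 1))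
    (s := (Int.negOnePow ((k : ℤ) - 1)) ^ (k + l)) (fun j _ => by
      rw [show j + (n : ℤ) - 1 = j - 1 + n by ring]
      exact windowDet_add_period _ (colExt_add_period k U) _) (j + 1) ()
  simp only [add_sub_cancel_right] at h1
  rw [h1]
  refine mul_ne_zero ?_ (h _ (Finset.mem_univ _))
  simp

/-- Multiplying `IsTwistPair.windowDet_mul` over one period shows that the twist inverts the product
of the window determinants up to sign. -/
theorem prod_windowDet_twistCol (k l n : ℕ) [NeZero n] (c : ℤ) : ∃ ε : ℤˣ,
    ∀ U : Matrix (Fin k ⊕ Fin l) (Fin n) ℝ, InMatCirc U →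
      (∏ i : Fin n, windowDet finSumFinEquiv.symm (twistCol U) ((i : ℤ) + c)) * windowProd U =
        ((ε : ℤ) : ℝ) := by
  obtain ⟨ε, h⟩ := prod_windowDet_shift (n := n) (finSumFinEquiv (m := k) (n := l)).symm
    (Int.negOnePow ((k : ℤ) - 1)) (c - l)
  refine ⟨ε * ∏ i : Fin n, windowSign (k + l) ((i : ℤ) + c), fun U hU => ?_⟩
  have h1 := h (colExt k U) (colExt_add_period k U)
  have h2 := Finset.prod_congr (rfl : (Finset.univ : Finset (Fin n)) = Finset.univ)
    fun i _ => (isTwistPair_twistCol hU).windowDet_mul finSumFinEquiv.symm ((i : ℤ) + c)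
  rw [Finset.prod_mul_distrib] at h2
  simp only [add_sub_assoc] at h2
  rw [h1] at h2
  have sq := unit_cast_mul_self ε
  push_cast
  rw [← h2, windowProd]
  linear_combination (-(∏ i : Fin n, windowDet finSumFinEquiv.symm (twistCol U) ((i : ℤ) + c)) *
    ∏ i : Fin n, windowDet finSumFinEquiv.symm (colExt k U) (i : ℤ)) * sq

theorem circProd_stwMat_fst (k l n : ℕ) [NeZero n] : ∃ ε : ℤˣ,
    ∀ (V : Matrix (Fin k) (Fin n) ℝ) (W : Matrix (Fin l) (Fin n) ℝ), InMatCirc (stack V W) →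
      circProd (stwMat V W).1 * windowProd (stack V W) = ((ε : ℤ) : ℝ) * circProd W := by
  obtain ⟨ε, h⟩ := circProd_mul_prod_windowDet (n := n) (finSumFinEquiv (m := k) (n := l)).symm l
    (Int.negOnePow ((k : ℤ) - 1))
    -- The first sign function compares the extension of the upper half of the twist by `colExt`
    -- with the quasi-period of `twistCol`; the next one compares the rules for `k` and for `l` on
    -- `W`.
    (fun j => colSign k n j * (Int.negOnePow ((n : ℤ) + ((k : ℤ) - 1))) ^ ((j - 1) / (n : ℤ)))
    (fun j => colSign k n j * colSign l n j)
  refine ⟨ε, fun V W hU => h _ _ _ _ (isTwistPair_twistCol hU) (colExt_add_period k _) ?_ ?_⟩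
  · intro j a
    rw [twistCol_eq hU, colExt_eq]
    have := unit_cast_mul_self ((Int.negOnePow ((n : ℤ) + ((k : ℤ) - 1))) ^ ((j - 1) / (n : ℤ)))
    rw [Units.val_mul, Int.cast_mul, mul_assoc, ← mul_assoc (((_ ^ _ : ℤˣ) : ℤ) : ℝ), this, one_mul]
    rfl
  · intro j a
    rw [← colExt_eq_colSign_mul]
    rfl

theorem circProd_stwMat_snd (k l n : ℕ) [NeZero n] : ∃ ε : ℤˣ,
    ∀ (V : Matrix (Fin k) (Fin n) ℝ) (W : Matrix (Fin l) (Fin n) ℝ), InMatCirc (stack V W) →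
      circProd (stwMat V W).2 * windowProd (stack V W) = ((ε : ℤ) : ℝ) * circProd V := by
  -- The two blocks of coordinates are exchanged, so that `p` is `l` and `q` is `k`. Now `V` is
  -- already extended by the rule for `k`, and its correction is trivial.
  obtain ⟨ε, h⟩ := circProd_mul_prod_windowDet (n := n)
    ((finSumFinEquiv (m := k) (n := l)).symm.trans (Equiv.sumComm _ _)) l
    (Int.negOnePow ((k : ℤ) - 1))
    (fun j => colSign l n j * (Int.negOnePow ((n : ℤ) + ((k : ℤ) - 1))) ^ ((j - 1) / (n : ℤ)))
    (fun _ => 1)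
  refine ⟨ε, fun V W hU => ?_⟩
  have h1 := h (fun j a => colExt k (stack V W) j a.swap) (fun j a => twistCol (stack V W) j a.swap)
    (stwMat V W).2 V ?_ (fun j a => colExt_add_period k _ j _) ?_ ?_
  · rw [← h1, windowProd]
    congr 1
    refine Finset.prod_congr rfl fun i _ => ?_
    rw [windowDet, windowDet]
    congr 1
    ext i t
    simp
  · intro a t ht
    rw [← isTwistPair_twistCol hU a t ht, dotProduct, dotProduct,
      ← (Equiv.sumComm (Fin l) (Fin k)).sum_comp]
    rfl
  · intro j a
    rw [twistCol_eq hU, colExt_eq]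
    have := unit_cast_mul_self ((Int.negOnePow ((n : ℤ) + ((k : ℤ) - 1))) ^ ((j - 1) / (n : ℤ)))
    rw [Units.val_mul, Int.cast_mul, mul_assoc, ← mul_assoc (((_ ^ _ : ℤˣ) : ℤ) : ℝ), this, one_mul]
    rfl
  · intro j a
    simp only [Units.val_one, Int.cast_one, one_mul]
    rfl

/-- The block diagonal matrix acting on stacked matrices. -/
abbrev blockDiag (g : Matrix (Fin k) (Fin k) ℝ) (h : Matrix (Fin l) (Fin l) ℝ) :
    Matrix (Fin k ⊕ Fin l) (Fin k ⊕ Fin l) ℝ := Matrix.fromBlocks g 0 0 h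

theorem colExt_stack_mul (s : ℕ) (g : Matrix (Fin k) (Fin k) ℝ) (h : Matrix (Fin l) (Fin l) ℝ)
    (V : Matrix (Fin k) (Fin n) ℝ) (W : Matrix (Fin l) (Fin n) ℝ) (j : ℤ) :
    colExt s (stack (g * V) (h * W)) j = blockDiag g h *ᵥ colExt s (stack V W) j := by
  ext (a | a)
  all_goals
    simp [colExt_eq, Matrix.mulVec, dotProduct, Matrix.mul_apply,
      Finset.mul_sum]
    exact Finset.sum_congr rfl fun _ _ => by ring

theorem windowProd_stack_mul (g : Matrix (Fin k) (Fin k) ℝ) (h : Matrix (Fin l) (Fin l) ℝ)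
    (V : Matrix (Fin k) (Fin n) ℝ) (W : Matrix (Fin l) (Fin n) ℝ) :
    windowProd (stack (g * V) (h * W)) = (g.det * h.det) ^ n * windowProd (stack V W) := by
  rw [windowProd, windowProd, funext (colExt_stack_mul k g h V W)]
  simp [windowDet_mulVec, Finset.prod_mul_distrib]

/-- One pair of representatives suffices, because row operations multiply `windowProd` by a nonzero
power of determinants. -/
theorem mem_stwDomain_iff {p : Gr k n × Gr l n} {V : Matrix (Fin k) (Fin n) ℝ}
    {W : Matrix (Fin l) (Fin n) ℝ} (hV : rowSpan V = p.1.1) (hW : rowSpan W = p.2.1) :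
    p ∈ stwDomain k l n ↔ InMatCirc (stack V W) := by
  refine ⟨fun h => h V W hV hW, fun h V' W' hV' hW' => ?_⟩
  obtain ⟨g, g', hg, rfl⟩ := exists_mul_eq hV hV'
  obtain ⟨a, a', ha, rfl⟩ := exists_mul_eq hW hW'
  rw [← windowProd_ne_zero_iff] at h ⊢
  rw [windowProd_stack_mul]
  refine mul_ne_zero (pow_ne_zero _ (mul_ne_zero ?_ ?_)) h
  · exact (Matrix.isUnit_det_of_left_inverse hg).ne_zero
  · exact (Matrix.isUnit_det_of_left_inverse ha).ne_zero

theorem mem_regularLocus_iff {X : Gr k n} {V : Matrix (Fin k) (Fin n) ℝ} (hV : rowSpan V = X.1) :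
    X ∈ regularLocus k n ↔ circProd V ≠ 0 := by
  simp only [regularLocus, Set.mem_ofPred_eq, ← circProd_ne_zero_iff]
  refine ⟨fun h => h V hV, fun h V' hV' => ?_⟩
  obtain ⟨g, g', hg, rfl⟩ := exists_mul_eq hV hV'
  rw [circProd_mul]
  exact mul_ne_zero (pow_ne_zero _ (Matrix.isUnit_det_of_left_inverse hg).ne_zero) h

theorem mem_goodLocus_iff {p : Gr k n × Gr l n} {V : Matrix (Fin k) (Fin n) ℝ}
    {W : Matrix (Fin l) (Fin n) ℝ} (hV : rowSpan V = p.1.1) (hW : rowSpan W = p.2.1) :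
    p ∈ goodLocus k l n ↔ windowProd (stack V W) ≠ 0 ∧ circProd V ≠ 0 ∧ circProd W ≠ 0 := by
  rw [goodLocus, Set.mem_inter_iff, Set.mem_prod, mem_stwDomain_iff hV hW, windowProd_ne_zero_iff,
    mem_regularLocus_iff hV, mem_regularLocus_iff hW]

/-- By the complementary minor identities, the circular products of the image vanish only if those
of `W` or `V` do. -/
theorem mapsTo_stw (hkl : k + l ≤ n) :
    Set.MapsTo stw (goodLocus k l n) (regularLocus k n ×ˢ regularLocus l n) := by
  intro p hp
  obtain ⟨V, hV⟩ := exists_rowSpan_eq p.1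
  obtain ⟨W, hW⟩ := exists_rowSpan_eq p.2
  obtain ⟨h1, h2, h3⟩ := (mem_goodLocus_iff hV hW).1 hp
  obtain ⟨h4, h5⟩ := isStw_stw hkl hp.1 V W hV hW
  obtain ⟨ε, hε⟩ := circProd_stwMat_fst k l n
  obtain ⟨δ, hδ⟩ := circProd_stwMat_snd k l n
  have hU := (windowProd_ne_zero_iff _).1 h1
  refine ⟨(mem_regularLocus_iff h4).2 fun h => ?_, (mem_regularLocus_iff h5).2 fun h => ?_⟩
  · have := hε V W hU
    rw [h, zero_mul] at this
    exact mul_ne_zero (by simp) h3 this.symm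
  · have := hδ V W hU
    rw [h, zero_mul] at this
    exact mul_ne_zero (by simp) h2 this.symm

end Twist

/-! ### The good locus is open and dense -/

section Locus

/-- At most `n` consecutive columns have distinct indices modulo `n`, so the window is a Vandermonde
matrix with distinct positive nodes, up to nonzero column factors. -/
theorem windowDet_colExt_ne_zero {N n d : ℕ} [NeZero n] {α : Type} (hN : N ≤ n) (e : Fin N ≃ α)
    {X : Matrix α (Fin n) ℝ} (hX : ∀ i c, X (e i) c = (((c : ℕ) : ℝ) + 1) ^ (d + (i : ℕ)))
    (s : ℕ) (j : ℤ) : windowDet e (colExt s X) j ≠ 0 := by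
  let c : Fin N → Fin n := fun t => colIndex n (j + (t : ℤ))
  have hc : Function.Injective c := by
    intro t t' h
    have h1 := (colIndex_eq_iff (j + (t : ℤ)) (c t)).1 rfl
    have h2 := (colIndex_eq_iff (j + (t' : ℤ)) (c t)).1 h.symm
    have h3 := dvd_sub h1 h2
    have h4 := Int.eq_zero_of_abs_lt_dvd h3 (by
      rw [abs_lt]
      have := t.2; have := t'.2
      constructor <;> omega)
    exact Fin.ext (by omega)
  have h1 : (Matrix.of fun i t : Fin N => colExt s X (j + (t : ℤ)) (e i)) =
      Matrix.of fun i t : Fin N => ((colSign s n (j + (t : ℤ)) : ℤ) * (((c t : ℕ) : ℝ) + 1) ^ d) *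
        (Matrix.vandermonde fun t => (((c t : ℕ) : ℝ) + 1))ᵀ i t := by
    ext i t
    simp only [Matrix.of_apply, colExt_eq, hX, Matrix.transpose_apply, Matrix.vandermonde_apply,
      pow_add, c]
    ring
  rw [windowDet, h1, Matrix.det_mul_row, Matrix.det_transpose]
  refine mul_ne_zero (Finset.prod_ne_zero_iff.2 fun t _ => ?_)
    (Matrix.det_vandermonde_ne_zero_iff.2 fun t t' h => hc (Fin.ext ?_))
  · refine mul_ne_zero (by simp) (pow_ne_zero _ ?_)
    positivity
  · simpa using h

/-- The powers `0, …, k - 1` go to `V` and `k, …, k + l - 1` to `W`, so `V`, `W` and their stack are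
all of Vandermonde type. -/
theorem exists_mem_goodLocus {k l n : ℕ} [NeZero n] (hkl : k + l ≤ n) :
    ∃ p, p ∈ goodLocus k l n := by
  let V : Matrix (Fin k) (Fin n) ℝ := Matrix.of fun i c => (((c : ℕ) : ℝ) + 1) ^ (i : ℕ)
  let W : Matrix (Fin l) (Fin n) ℝ := Matrix.of fun i c => (((c : ℕ) : ℝ) + 1) ^ (k + (i : ℕ))
  have hU : windowProd (stack V W) ≠ 0 := by
    rw [windowProd_ne_zero_iff, inMatCirc_iff]
    refine windowDet_colExt_ne_zero (d := 0) hkl _ (fun i c => ?_) k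
    induction i using Fin.addCases <;> simp [V, W]
  have hV : circProd V ≠ 0 := (circProd_ne_zero_iff V).2 fun i =>
    windowDet_colExt_ne_zero (d := 0) (by omega) (Equiv.refl _) (fun i c => by simp [V]) k _
  have hW : circProd W ≠ 0 := (circProd_ne_zero_iff W).2 fun i =>
    windowDet_colExt_ne_zero (d := k) (by omega) (Equiv.refl _) (fun i c => by simp [W]) l _
  have hind : ∀ {r : ℕ} {X : Matrix (Fin r) (Fin n) ℝ}, circProd X ≠ 0 →
      LinearIndependent ℝ X.row := by
    intro r X hX
    have h0 := (circProd_ne_zero_iff X).1 hX 0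
    rw [← Matrix.vecMul_injective_iff, ← Matrix.coe_vecMulLinear, injective_iff_map_eq_zero]
    intro c hc
    refine Matrix.eq_zero_of_vecMul_eq_zero h0 ?_
    ext b
    have h1 := congrFun hc (colIndex n (((0 : Fin n) : ℕ) + 1 + (b : ℤ)))
    simp only [Matrix.coe_vecMulLinear, Matrix.vecMul, dotProduct, Pi.zero_apply] at h1
    simp only [Matrix.vecMul, dotProduct, Matrix.of_apply, colExt_eq, Pi.zero_apply]
    rw [← mul_zero ((colSign r n (((0 : Fin n) : ℕ) + 1 + (b : ℤ)) : ℤ) : ℝ), ← h1, Finset.mul_sum]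
    exact Finset.sum_congr rfl fun _ _ => by ring
  exact ⟨(⟨rowSpan V, finrank_rowSpan (hind hV)⟩, ⟨rowSpan W, finrank_rowSpan (hind hW)⟩),
    (mem_goodLocus_iff rfl rfl).2 ⟨hU, hV, hW⟩⟩

/-! ### Analyticity of the minors in the charts -/

theorem analyticAt_det {E ι : Type} [NormedAddCommGroup E] [NormedSpace ℝ E] [Fintype ι]
    [DecidableEq ι] {M : E → Matrix ι ι ℝ} {p : E} (h : ∀ i j, AnalyticAt ℝ (fun q => M q i j) p) :
    AnalyticAt ℝ (fun q => (M q).det) p := by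
  simp only [Matrix.det_apply']
  refine Finset.analyticAt_fun_sum _ fun σ _ => ?_
  exact analyticAt_const.mul (Finset.analyticAt_fun_prod _ fun i _ => h _ _)

theorem analyticAt_chartMatrix {k n : ℕ} (A : Coords k n) (i : Fin k) (j : Fin n) :
    AnalyticAt ℝ (fun A : Coords k n => chartMatrix A i j) A := by
  simp only [chartMatrix, Matrix.of_apply]
  split_ifs
  · exact analyticAt_const
  · exact analyticAt_const
  · exact ((ContinuousLinearMap.proj (R := ℝ) (φ := fun _ : Fin (n - k) => ℝ) _).comp
      (ContinuousLinearMap.proj (R := ℝ) (φ := fun _ : Fin k => Fin (n - k) → ℝ) i)).analyticAt A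

variable {k l n : ℕ}

/-- The matrix `stack([Id | A], [Id | B])` with coordinates `(A, B)`. -/
def chartStack (p : Coords k n × Coords l n) : Matrix (Fin k ⊕ Fin l) (Fin n) ℝ :=
  stack (chartMatrix p.1) (chartMatrix p.2)

theorem analyticAt_chartStack (p : Coords k n × Coords l n) (i : Fin k ⊕ Fin l) (j : Fin n) :
    AnalyticAt ℝ (fun p : Coords k n × Coords l n => chartStack p i j) p := by
  rcases i with i | i
  · exact (analyticAt_chartMatrix p.1 i j).comp analyticAt_fst
  · exact (analyticAt_chartMatrix p.2 i j).comp analyticAt_snd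

variable [NeZero n]

/-- The product of all the minors that do not vanish on the good locus. -/
def locusFun (p : Coords k n × Coords l n) : ℝ :=
  windowProd (chartStack p) * (circProd (chartMatrix p.1) * circProd (chartMatrix p.2))

theorem analyticAt_locusFun (p : Coords k n × Coords l n) : AnalyticAt ℝ locusFun p := by
  refine AnalyticAt.mul ?_ (AnalyticAt.mul ?_ ?_)
  · refine Finset.analyticAt_fun_prod _ fun i _ => analyticAt_det fun r t => ?_
    simp only [Matrix.of_apply, colExt_eq]
    exact analyticAt_const.mul (analyticAt_chartStack p _ _)
  · refine Finset.analyticAt_fun_prod _ fun i _ => analyticAt_det fun r t => ?_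
    simp only [Matrix.of_apply, colExt_eq]
    exact analyticAt_const.mul ((analyticAt_chartMatrix p.1 _ _).comp analyticAt_fst)
  · refine Finset.analyticAt_fun_prod _ fun i _ => analyticAt_det fun r t => ?_
    simp only [Matrix.of_apply, colExt_eq]
    exact analyticAt_const.mul ((analyticAt_chartMatrix p.2 _ _).comp analyticAt_snd)

theorem preimage_goodLocus (hk : k ≤ n) (hl : l ≤ n) :
    chartProd hk hl ⁻¹' goodLocus k l n = {p | locusFun p ≠ 0} := by
  ext p
  rw [Set.mem_preimage, mem_goodLocus_iff (p := chartProd hk hl p) (V := chartMatrix p.1)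
    (W := chartMatrix p.2) rfl rfl, Set.mem_ofPred_eq, locusFun, mul_ne_zero_iff, mul_ne_zero_iff]
  rfl

theorem isOpen_preimage_goodLocus (hk : k ≤ n) (hl : l ≤ n) :
    IsOpen (chartProd hk hl ⁻¹' goodLocus k l n) := by
  rw [preimage_goodLocus]
  refine isOpen_ne_fun ?_ continuous_const
  exact continuous_iff_continuousAt.2 fun p => (analyticAt_locusFun p).continuousAt

/-- Identity principle: if `locusFun` vanished near a point it would vanish everywhere, against the
existence of a good point, which lies in the chart. -/
theorem dense_preimage_goodLocus (hkl : k + l ≤ n) (hk : k ≤ n) (hl : l ≤ n) :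
    Dense (chartProd hk hl ⁻¹' goodLocus k l n) := by
  obtain ⟨q, hq⟩ := exists_mem_goodLocus hkl
  have hp : (coord q.1, coord q.2) ∈ chartProd hk hl ⁻¹' goodLocus k l n := by
    have : chartProd hk hl (coord q.1, coord q.2) = q :=
      Prod.ext (chart_coord hk hq.2.1) (chart_coord hl hq.2.2)
    rwa [Set.mem_preimage, this]
  rw [preimage_goodLocus] at hp ⊢
  intro p
  by_contra hcl
  have h1 : {q : Coords k n × Coords l n | locusFun q ≠ 0}ᶜ ∈ 𝓝 p := by
    have := isClosed_closure.isOpen_compl.mem_nhds (Set.mem_compl hcl)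
    exact Filter.mem_of_superset this (Set.compl_subset_compl.2 subset_closure)
  have h2 : (locusFun : Coords k n × Coords l n → ℝ) =ᶠ[𝓝 p] 0 := by
    filter_upwards [h1] with q hq
    simpa using hq
  have h3 : (locusFun : Coords k n × Coords l n → ℝ) = 0 :=
    AnalyticOnNhd.eq_of_eventuallyEq (𝕜 := ℝ) (fun p _ => analyticAt_locusFun p)
      (fun _ _ => analyticAt_const) h2
  exact hp (congrFun h3 _)

end Locus

/-! ### Determinants of linear maps -/

section Determinants

theorem exists_unit_of_mul_self {r : ℝ} (h : r * r = 1) : ∃ ε : ℤˣ, r = ((ε : ℤ) : ℝ) := by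
  rcases mul_self_eq_one_iff.1 h with rfl | rfl
  · exact ⟨1, by simp⟩
  · exact ⟨-1, by simp⟩

section Shear

variable {A B : Type} [AddCommGroup A] [Module ℝ A] [AddCommGroup B] [Module ℝ B]

/-- The shear `(a, b) ↦ (a + φ b, b)`. -/
def shear (φ : B →ₗ[ℝ] A) : A × B →ₗ[ℝ] A × B :=
  LinearMap.prod (LinearMap.fst ℝ A B + φ ∘ₗ LinearMap.snd ℝ A B) (LinearMap.snd ℝ A B)

@[simp] theorem shear_apply (φ : B →ₗ[ℝ] A) (x : A × B) : shear φ x = (x.1 + φ x.2, x.2) := rfl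

/-- Doubling the first factor conjugates the shear to its own square. So its determinant equals its
square, and is nonzero because the shear is invertible. No basis is needed. -/
theorem det_shear (φ : B →ₗ[ℝ] A) : LinearMap.det (shear φ) = 1 := by
  let D : (A × B) ≃ₗ[ℝ] (A × B) :=
    LinearEquiv.prodCongr (LinearEquiv.smulOfNeZero ℝ A (2 : ℝ) two_ne_zero)
      (LinearEquiv.refl ℝ B)
  have h1 : D.toLinearMap ∘ₗ shear φ ∘ₗ D.symm.toLinearMap = shear φ ∘ₗ shear φ := by
    refine LinearMap.ext fun x => ?_
    obtain ⟨y, rfl⟩ := D.surjective x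
    simp only [LinearMap.comp_apply, LinearEquiv.coe_coe, LinearEquiv.symm_apply_apply]
    refine Prod.ext ?_ rfl
    change (2 : ℝ) • (y.1 + φ y.2) = (2 : ℝ) • y.1 + φ y.2 + φ y.2
    rw [smul_add, two_smul ℝ (φ y.2)]
    abel
  have h2 := LinearMap.det_conj (shear φ) D
  rw [h1, LinearMap.det_comp] at h2
  have h3 : shear φ ∘ₗ shear (-φ) = LinearMap.id := by
    refine LinearMap.ext fun x => Prod.ext ?_ rfl
    simp
  have h4 := congrArg LinearMap.det h3
  rw [LinearMap.det_comp, LinearMap.det_id] at h4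
  exact mul_left_cancel₀ (left_ne_zero_of_mul_eq_one h4) (h2.trans (mul_one _).symm)

end Shear

/-- The transposition followed by a conjugation. -/
def conjTranspose {r : ℕ} (c c' : Matrix (Fin r) (Fin r) ℝ) :
    Matrix (Fin r) (Fin r) ℝ →ₗ[ℝ] Matrix (Fin r) (Fin r) ℝ where
  toFun Z := c' * Zᵀ * c
  map_add' Y Z := by rw [Matrix.transpose_add, Matrix.mul_add, Matrix.add_mul]
  map_smul' a Z := by simp

theorem det_mulRight {r : ℕ} (c : Matrix (Fin r) (Fin r) ℝ) :
    LinearMap.det (LinearMap.mulRight ℝ c) = c.det ^ r := by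
  have h : (LinearMap.mulRight ℝ c : Matrix (Fin r) (Fin r) ℝ →ₗ[ℝ] Matrix (Fin r) (Fin r) ℝ) =
      LinearMap.pi fun i : Fin r => (Matrix.toLin' cᵀ) ∘ₗ LinearMap.proj i := by
    refine LinearMap.ext fun Z => ?_
    ext i j
    change (Z * c) i j = (cᵀ *ᵥ Z i) j
    simp [Matrix.mul_apply, Matrix.mulVec, dotProduct, mul_comm]
  have h2 := LinearMap.det_pi fun _ : Fin r => Matrix.toLin' cᵀ
  simp only [LinearMap.det_toLin', Matrix.det_transpose, Finset.prod_const, Finset.card_univ,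
    Fintype.card_fin] at h2
  rw [← h2, h]
  rfl

/-- The map is a right multiplication by `c'ᵀ`, a transposition, and a right multiplication by `c`.
The outer determinants cancel and the transposition is an involution. -/
theorem det_conjTranspose (r : ℕ) : ∃ ε : ℤˣ, ∀ c c' : Matrix (Fin r) (Fin r) ℝ, c' * c = 1 →
    LinearMap.det (conjTranspose c c') = ((ε : ℤ) : ℝ) := by
  let T := Matrix.transposeLinearEquiv (Fin r) (Fin r) ℝ ℝ
  have hTT : ∀ Z, T (T Z) = Z := Matrix.transpose_transpose
  obtain ⟨ε, hε⟩ := exists_unit_of_mul_self (r := LinearMap.det T.toLinearMap) (by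
    rw [← LinearMap.det_comp]
    have : T.toLinearMap ∘ₗ T.toLinearMap = LinearMap.id := LinearMap.ext hTT
    rw [this, LinearMap.det_id])
  refine ⟨ε, fun c c' h => ?_⟩
  have h1 : conjTranspose c c' = LinearMap.mulRight ℝ c ∘ₗ T.toLinearMap ∘ₗ
      LinearMap.mulRight ℝ c'ᵀ := by
    refine LinearMap.ext fun Z => ?_
    simp [conjTranspose, T]
  rw [h1, LinearMap.det_comp, LinearMap.det_comp, det_mulRight, det_mulRight, hε,
    Matrix.det_transpose, mul_comm (c.det ^ r), mul_assoc, ← mul_pow, ← Matrix.det_mul, h]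
  simp

/-! ### Pairings of matrices with windows of vectors -/

variable {k l n : ℕ}

/-- The real matrices with rows indexed by `Fin k ⊕ Fin l`, as families of columns. -/
abbrev Cols (k l n : ℕ) : Type := Fin n → Fin k ⊕ Fin l → ℝ

/-- Left multiplication by a square matrix. -/
def mulCols (C : Matrix (Fin k ⊕ Fin l) (Fin k ⊕ Fin l) ℝ) : Cols k l n →ₗ[ℝ] Cols k l n :=
  LinearMap.pi fun b => Matrix.toLin' C ∘ₗ LinearMap.proj b

theorem mulCols_apply (C : Matrix (Fin k ⊕ Fin l) (Fin k ⊕ Fin l) ℝ) (X : Cols k l n)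
    (b : Fin n) : mulCols C X b = C *ᵥ X b := rfl

theorem det_mulCols (C : Matrix (Fin k ⊕ Fin l) (Fin k ⊕ Fin l) ℝ) :
    LinearMap.det (mulCols (n := n) C) = C.det ^ n := by
  rw [mulCols, LinearMap.det_pi]
  simp

/-- The pairings of the columns of a matrix with the vectors of the windows of `x`. -/
def pairLeft (x : ℤ → Fin k ⊕ Fin l → ℝ) : Cols k l n →ₗ[ℝ] Cols k l n :=
  LinearMap.pi fun a => Matrix.toLin' (Matrix.of fun s r =>
    x ((a : ℤ) + 1 - l + ((finSumFinEquiv s : Fin (k + l)) : ℤ)) r) ∘ₗ LinearMap.proj a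

theorem pairLeft_apply (x : ℤ → Fin k ⊕ Fin l → ℝ) (Y : Cols k l n) (a : Fin n)
    (s : Fin k ⊕ Fin l) : pairLeft x Y a s =
      Y a ⬝ᵥ x ((a : ℤ) + 1 - l + ((finSumFinEquiv s : Fin (k + l)) : ℤ)) := by
  simp [pairLeft, Matrix.mulVec, dotProduct_comm]

/-- The map is block diagonal, with one block per column, given by the window attached to that
column. -/
theorem det_pairLeft (x : ℤ → Fin k ⊕ Fin l → ℝ) :
    LinearMap.det (pairLeft (n := n) x) =
      ∏ a : Fin n, windowDet finSumFinEquiv.symm x ((a : ℤ) + (1 - l)) := by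
  rw [pairLeft, LinearMap.det_pi]
  refine Finset.prod_congr rfl fun a _ => ?_
  rw [LinearMap.det_toLin', windowDet, ← Matrix.det_submatrix_equiv_self finSumFinEquiv,
    ← Matrix.det_transpose]
  congr 1
  ext r s
  simp only [Matrix.transpose_apply, Matrix.of_apply, Matrix.submatrix_apply,
    Equiv.symm_apply_apply]
  congr 1
  ring

theorem det_signed_perm {κ : Type} [Fintype κ] [DecidableEq κ] (π : Equiv.Perm κ) (ε : κ → ℤˣ)
    (T : (κ → ℝ) →ₗ[ℝ] (κ → ℝ)) (hT : ∀ X i, T X i = ((ε i : ℤ) : ℝ) * X (π i)) :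
    LinearMap.det T = ((((∏ i, ε i) * Equiv.Perm.sign π : ℤˣ) : ℤ) : ℝ) := by
  have h : T = Matrix.toLin' (Matrix.of fun i j => ((ε i : ℤ) : ℝ) *
      ((1 : Matrix κ κ ℝ).submatrix π id) i j) := by
    refine LinearMap.ext fun X => funext fun i => ?_
    rw [hT, Matrix.toLin'_apply, Matrix.mulVec, dotProduct]
    simp [Matrix.one_apply]
  rw [h, LinearMap.det_toLin', Matrix.det_mul_column, Matrix.det_permute, Matrix.det_one]
  push_cast; ring

variable [NeZero n]

theorem colIndex_shift_bijective (c : ℤ) :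
    Function.Bijective fun a : Fin n => colIndex n ((a : ℤ) + c) := by
  rw [Fintype.bijective_iff_injective_and_card]
  refine ⟨fun a a' h => ?_, rfl⟩
  have h1 := (colIndex_eq_iff (n := n) ((a : ℤ) + c) (colIndex n ((a : ℤ) + c))).1 rfl
  have h2 := (colIndex_eq_iff (n := n) ((a' : ℤ) + c) (colIndex n ((a : ℤ) + c))).1 h.symm
  have h3 := dvd_sub h1 h2
  have h4 := Int.eq_zero_of_abs_lt_dvd h3 (by
    rw [abs_lt]
    have := a.2; have := a'.2
    constructor <;> omega)
  exact Fin.ext (by omega)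

theorem colExt_transpose_add (s : ℕ) (X Y : Cols k l n) (j : ℤ) :
    colExt s (Matrix.of (X + Y))ᵀ j = colExt s (Matrix.of X)ᵀ j + colExt s (Matrix.of Y)ᵀ j := by
  ext r
  simp [colExt_eq, mul_add]

/-- The pairings of the vectors `y` with the columns of a matrix, extended to all integers. -/
def pairRight (y : ℤ → Fin k ⊕ Fin l → ℝ) : Cols k l n →ₗ[ℝ] Cols k l n where
  toFun X a s := y ((a : ℤ) + 1) ⬝ᵥ colExt k (Matrix.of X)ᵀ
    ((a : ℤ) + 1 - l + ((finSumFinEquiv s : Fin (k + l)) : ℤ))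
  map_add' X Y := by
    ext a s
    rw [colExt_transpose_add, dotProduct_add]
    rfl
  map_smul' c X := by
    ext a s
    simp only [dotProduct, colExt_eq, Pi.smul_apply, smul_eq_mul, Finset.mul_sum, RingHom.id_apply,
      Matrix.transpose_apply, Matrix.of_apply]
    exact Finset.sum_congr rfl fun _ _ => by ring

theorem pairRight_apply (y : ℤ → Fin k ⊕ Fin l → ℝ) (X : Cols k l n) (a : Fin n)
    (s : Fin k ⊕ Fin l) : pairRight y X a s = y ((a : ℤ) + 1) ⬝ᵥ colExt k (Matrix.of X)ᵀ
      ((a : ℤ) + 1 - l + ((finSumFinEquiv s : Fin (k + l)) : ℤ)) := rfl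

/-- Grouped by the column of `X` rather than by `a`, the pairings become block diagonal: a given
column meets a reversed window of `y`. The regrouping is a signed permutation of the entries. -/
theorem det_pairRight (k l n : ℕ) [NeZero n] (σ : ℤˣ) : ∃ ε : ℤˣ,
    ∀ y : ℤ → Fin k ⊕ Fin l → ℝ, (∀ j a, y (j + n) a = ((σ : ℤ) : ℝ) * y j a) →
      LinearMap.det (pairRight (n := n) y) = ((ε : ℤ) : ℝ) *
        ∏ a : Fin n, windowDet finSumFinEquiv.symm y ((a : ℤ) + (2 - k)) := by
  let b : Fin n → Fin k ⊕ Fin l → ℤ := fun a s =>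
    (a : ℤ) + 1 - l + ((finSumFinEquiv s : Fin (k + l)) : ℤ)
  have hbij : ∀ s, Function.Bijective fun a : Fin n => colIndex n (b a s) := by
    intro s
    have := colIndex_shift_bijective (n := n) (1 - l + ((finSumFinEquiv s : Fin (k + l)) : ℤ))
    refine Eq.mp ?_ this
    congr 1
    ext a
    simp only [b]
    rw [show (a : ℤ) + (1 - l + ((finSumFinEquiv s : Fin (k + l)) : ℤ)) =
      (a : ℤ) + 1 - l + ((finSumFinEquiv s : Fin (k + l)) : ℤ) by ring]
  have hπ : Function.Bijective fun i : Fin n × (Fin k ⊕ Fin l) =>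
      (colIndex n (b i.1 i.2), i.2) := by
    rw [Fintype.bijective_iff_injective_and_card]
    refine ⟨fun i i' h => ?_, rfl⟩
    obtain ⟨a, s⟩ := i
    obtain ⟨a', s'⟩ := i'
    obtain ⟨h1, rfl⟩ := Prod.ext_iff.1 h
    exact Prod.ext ((hbij s).1 h1) rfl
  let π := Equiv.ofBijective _ hπ
  -- Reducing the column index modulo `n` costs the wrap-around sign of `X` and, after moving `y` by
  -- the same multiple of `n`, that of `y`.
  let ε₀ : Fin n × (Fin k ⊕ Fin l) → ℤˣ := fun i =>
    colSign k n (b i.1 i.2) * σ ^ ((b i.1 i.2 - 1) / (n : ℤ))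
  let cur := LinearEquiv.curry ℝ ℝ (Fin n) (Fin k ⊕ Fin l)
  let T : (Fin n × (Fin k ⊕ Fin l) → ℝ) →ₗ[ℝ] (Fin n × (Fin k ⊕ Fin l) → ℝ) :=
    { toFun := fun X i => ((ε₀ i : ℤ) : ℝ) * X (π i)
      map_add' := fun X Y => funext fun i => mul_add _ _ _
      map_smul' := fun c X => funext fun i => mul_left_comm _ _ _ }
  refine ⟨(∏ i, ε₀ i) * Equiv.Perm.sign π *
    ∏ _a : Fin n, Equiv.Perm.sign (Fin.revPerm (n := k + l)), fun y hy => ?_⟩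
  -- Column `a + 1` occurs at position `s` of the window of `y (a + 1 + l - s)`. These indices run
  -- down to `a + 2 - k`, whence the start of the window and the sign of the reversal.
  let F : Cols k l n →ₗ[ℝ] Cols k l n :=
    LinearMap.pi fun a => Matrix.toLin' (Matrix.of fun s r =>
      y ((a : ℤ) + 1 + l - ((finSumFinEquiv s : Fin (k + l)) : ℤ)) r) ∘ₗ LinearMap.proj a
  have hF : LinearMap.det F = (((∏ _a : Fin n, Equiv.Perm.sign (Fin.revPerm (n := k + l)) : ℤˣ) :
      ℤ) : ℝ) * ∏ a : Fin n, windowDet finSumFinEquiv.symm y ((a : ℤ) + (2 - k)) := by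
    push_cast
    rw [LinearMap.det_pi, ← Finset.prod_mul_distrib]
    refine Finset.prod_congr rfl fun a _ => ?_
    rw [LinearMap.det_toLin', windowDet, ← Matrix.det_permute',
      ← Matrix.det_submatrix_equiv_self (finSumFinEquiv (m := k) (n := l)),
      ← Matrix.det_transpose]
    congr 1
    ext r s
    simp only [Matrix.transpose_apply, Matrix.of_apply, Matrix.submatrix_apply,
      Equiv.symm_apply_apply, id_eq, Fin.revPerm_apply, Fin.val_rev]
    congr 1
    have := (finSumFinEquiv s : Fin (k + l)).2
    omega
  have hcomp : pairRight y = (cur.toLinearMap ∘ₗ T ∘ₗ cur.symm.toLinearMap) ∘ₗ F := by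
    refine LinearMap.ext fun X => funext fun a => funext fun s => ?_
    have hs := eq_colIndex_add (n := n) (b a s)
    have h1 : ∀ r, y ((a : ℤ) + 1) r = (((σ ^ ((b a s - 1) / (n : ℤ)) : ℤˣ) : ℤ) : ℝ) *
        y (((colIndex n (b a s) : Fin n) : ℕ) + 1 + l -
          ((finSumFinEquiv s : Fin (k + l)) : ℤ)) r := by
      intro r
      have h2 := eq_pow_mul_of_period (n := n)
        (x := fun j => y (j + l - ((finSumFinEquiv s : Fin (k + l)) : ℤ))) (s := σ)
        (fun j a => by
          rw [show j + (n : ℤ) + l - ((finSumFinEquiv s : Fin (k + l)) : ℤ) =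
            j + l - ((finSumFinEquiv s : Fin (k + l)) : ℤ) + n by ring]
          exact hy _ _) (b a s) r
      rw [← h2]
      congr 1
      simp only [b]
      ring
    rw [pairRight_apply]
    change _ = (((colSign k n (b a s) * σ ^ ((b a s - 1) / (n : ℤ)) : ℤˣ) : ℤ) : ℝ) *
      F X (colIndex n (b a s)) s
    simp only [F, LinearMap.pi_apply, LinearMap.comp_apply, Matrix.toLin'_apply, Matrix.mulVec,
      dotProduct, LinearMap.proj_apply, Matrix.of_apply, Finset.mul_sum, h1]
    refine Finset.sum_congr rfl fun r _ => ?_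
    rw [colExt_eq]
    simp only [Matrix.transpose_apply, Matrix.of_apply, b]
    push_cast; ring
  rw [hcomp, LinearMap.det_comp, LinearMap.det_conj, hF, det_signed_perm π ε₀ T fun _ _ => rfl]
  push_cast; ring

end Determinants

/-! ### The infinitesimal action of the row operations and the chart directions -/

section Blocks

variable {k l n : ℕ}

/-- The block matrix `[Z | A]`. -/
def joinBlocks (Z : Matrix (Fin k) (Fin k) ℝ) (A : Coords k n) : Matrix (Fin k) (Fin n) ℝ :=
  Matrix.of fun i j =>
    if h : (j : ℕ) < k then Z i ⟨j, h⟩ else A i ⟨(j : ℕ) - k, by have := j.2; omega⟩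

/-- The product `Z * A`, as coordinates. -/
def mulCoords (Z : Matrix (Fin k) (Fin k) ℝ) (A : Coords k n) : Coords k n :=
  fun i j => ∑ r, Z i r * A r j

/-- A matrix direction at `[Id | A]` is a row operation plus a chart direction; in block coordinates
this splitting is a shear, so it does not affect determinants. -/
theorem joinBlocks_add_mulCoords (Z : Matrix (Fin k) (Fin k) ℝ) (A B : Coords k n) :
    joinBlocks Z (B + mulCoords Z A) = Z * chartMatrix A + joinBlocks 0 B := by
  ext i j
  simp only [joinBlocks, Matrix.of_apply, Matrix.add_apply, Matrix.mul_apply, chartMatrix,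
    Pi.add_apply, mulCoords, Matrix.zero_apply]
  split_ifs with h
  · rw [Finset.sum_eq_single ⟨j, h⟩]
    · simp
    · intro r _ hr
      rw [if_neg fun h' => hr (Fin.ext h'), mul_zero]
    · simp
  · rw [add_comm]

theorem joinBlocks_zero_neg (A : Coords k n) :
    joinBlocks 0 (-A) = -joinBlocks 0 A := by
  ext i j
  simp only [joinBlocks, Matrix.of_apply, Matrix.neg_apply, Pi.neg_apply, Matrix.zero_apply]
  split_ifs <;> simp

/-- The linear isomorphism `((A, B), (Y, Z)) ↦ stack([Y | A], [Z | B])`. -/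
def blocksEquiv (hk : k ≤ n) (hl : l ≤ n) :
    ((Coords k n × Coords l n) × (Matrix (Fin k) (Fin k) ℝ × Matrix (Fin l) (Fin l) ℝ)) ≃ₗ[ℝ]
      Cols k l n where
  toFun w b := Sum.elim (fun i => joinBlocks w.2.1 w.1.1 i b) fun i => joinBlocks w.2.2 w.1.2 i b
  map_add' w w' := by
    funext b
    ext (i | i)
    all_goals
      simp only [joinBlocks, Matrix.of_apply, Sum.elim_inl, Sum.elim_inr, Pi.add_apply,
        Prod.fst_add, Prod.snd_add, Matrix.add_apply]
      split_ifs <;> rfl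
  map_smul' a w := by
    funext b
    ext (i | i)
    all_goals
      simp only [joinBlocks, Matrix.of_apply, Sum.elim_inl, Sum.elim_inr, Pi.smul_apply,
        Prod.smul_fst, Prod.smul_snd, Matrix.smul_apply, RingHom.id_apply]
      split_ifs <;> rfl
  invFun X := ((fun i j => X ⟨k + j, by have := j.2; omega⟩ (Sum.inl i),
      fun i j => X ⟨l + j, by have := j.2; omega⟩ (Sum.inr i)),
    (Matrix.of fun i j => X (Fin.castLE hk j) (Sum.inl i),
      Matrix.of fun i j => X (Fin.castLE hl j) (Sum.inr i)))
  left_inv w := by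
    refine Prod.ext (Prod.ext ?_ ?_) (Prod.ext ?_ ?_)
    all_goals
      ext i j
      simp [joinBlocks]
  right_inv X := by
    funext b
    ext (i | i)
    all_goals
      simp only [joinBlocks, Matrix.of_apply, Sum.elim_inl, Sum.elim_inr]
      split_ifs with h
      · rfl
      · congr 2
        omega

theorem of_blocksEquiv_transpose (hk : k ≤ n) (hl : l ≤ n)
    (w : (Coords k n × Coords l n) × (Matrix (Fin k) (Fin k) ℝ × Matrix (Fin l) (Fin l) ℝ)) :
    (Matrix.of (blocksEquiv hk hl w))ᵀ =
      stack (joinBlocks w.2.1 w.1.1) (joinBlocks w.2.2 w.1.2) := by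
  ext (i | i) j <;> rfl

theorem blocksEquiv_apply (hk : k ≤ n) (hl : l ≤ n)
    (w : (Coords k n × Coords l n) × (Matrix (Fin k) (Fin k) ℝ × Matrix (Fin l) (Fin l) ℝ))
    (b : Fin n) : blocksEquiv hk hl w b =
      (stack (joinBlocks w.2.1 w.1.1) (joinBlocks w.2.2 w.1.2))ᵀ b := by
  ext (i | i) <;> rfl

/-- The linear map `(Y, Z) ↦ (Y * A, Z * B)`. -/
def mulCoordsMap (p : Coords k n × Coords l n) :
    (Matrix (Fin k) (Fin k) ℝ × Matrix (Fin l) (Fin l) ℝ) →ₗ[ℝ] Coords k n × Coords l n where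
  toFun Z := (mulCoords Z.1 p.1, mulCoords Z.2 p.2)
  map_add' Y Z := by
    refine Prod.ext ?_ ?_ <;> ext i j <;>
      simp [mulCoords, add_mul, Finset.sum_add_distrib]
  map_smul' a Z := by
    refine Prod.ext ?_ ?_ <;> ext i j <;>
      simp [mulCoords, Finset.mul_sum, mul_assoc]

/-- The shear `(a, b) ↦ (a, b + ψ a)`. -/
def shearSnd {A B : Type} [AddCommGroup A] [Module ℝ A] [AddCommGroup B] [Module ℝ B]
    (ψ : A →ₗ[ℝ] B) : A × B →ₗ[ℝ] A × B :=
  LinearMap.prod (LinearMap.fst ℝ A B) (LinearMap.snd ℝ A B + ψ ∘ₗ LinearMap.fst ℝ A B)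

theorem det_shearSnd {A B : Type} [AddCommGroup A] [Module ℝ A] [AddCommGroup B] [Module ℝ B]
    (ψ : A →ₗ[ℝ] B) : LinearMap.det (shearSnd ψ) = 1 := by
  rw [← det_shear ψ, ← LinearMap.det_conj (shear ψ) (LinearEquiv.prodComm ℝ B A)]
  rfl

variable [NeZero n]

theorem colExt_stack_add (s : ℕ) (V V' : Matrix (Fin k) (Fin n) ℝ) (W W' : Matrix (Fin l) (Fin n) ℝ)
    (j : ℤ) : colExt s (stack (V + V') (W + W')) j =
      colExt s (stack V W) j + colExt s (stack V' W') j := by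
  ext (i | i) <;> simp [colExt_eq, mul_add]

/-- The relation between the Jacobian determinant of the stacked twist in the charts and the
determinants of the two pairings. -/
theorem det_pairRight_eq (k l n : ℕ) [NeZero n] (hk : k ≤ n) (hl : l ≤ n) : ∃ ε : ℤˣ,
    ∀ (p q : Coords k n × Coords l n) (y : ℤ → Fin k ⊕ Fin l → ℝ)
      (c : Matrix (Fin k) (Fin k) ℝ) (d : Matrix (Fin l) (Fin l) ℝ)
      (L : (Coords k n × Coords l n) →ₗ[ℝ] (Coords k n × Coords l n))
      (γ : (Coords k n × Coords l n) →ₗ[ℝ] Matrix (Fin k) (Fin k) ℝ)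
      (δ : (Coords k n × Coords l n) →ₗ[ℝ] Matrix (Fin l) (Fin l) ℝ),
      c.det ≠ 0 → d.det ≠ 0 →
      (∀ b : Fin n, y ((b : ℤ) + 1) =
        (stack (c * chartMatrix q.1) (d * chartMatrix q.2))ᵀ b) →
      (∀ (e : Coords k n × Coords l n) (a : Fin n) (s : Fin k ⊕ Fin l),
        (stack (γ e * chartMatrix q.1 + c * joinBlocks 0 (L e).1)
          (δ e * chartMatrix q.2 + d * joinBlocks 0 (L e).2))ᵀ a ⬝ᵥ
            colExt k (chartStack p) ((a : ℤ) + 1 - l + ((finSumFinEquiv s : Fin (k + l)) : ℤ)) +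
          y ((a : ℤ) + 1) ⬝ᵥ colExt k (stack (joinBlocks 0 e.1) (joinBlocks 0 e.2))
            ((a : ℤ) + 1 - l + ((finSumFinEquiv s : Fin (k + l)) : ℤ)) = 0) →
      LinearMap.det (pairRight (n := n) y) = ((ε : ℤ) : ℝ) *
        (LinearMap.det (pairLeft (n := n) (colExt k (chartStack p))) * (c.det * d.det) ^ n *
          LinearMap.det L) := by
  obtain ⟨ε₁, h₁⟩ := det_conjTranspose k
  obtain ⟨ε₂, h₂⟩ := det_conjTranspose l
  refine ⟨ε₁ * ε₂ * (-1) ^ Module.finrank ℝ (Coords k n × Coords l n),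
    fun p q y c d L γ δ hc hd hy hband => ?_⟩
  have hcc : c⁻¹ * c = 1 := Matrix.nonsing_inv_mul _ (isUnit_iff_ne_zero.2 hc)
  have hdd : d⁻¹ * d = 1 := Matrix.nonsing_inv_mul _ (isUnit_iff_ne_zero.2 hd)
  have hcc' : c * c⁻¹ = 1 := Matrix.mul_nonsing_inv _ (isUnit_iff_ne_zero.2 hc)
  have hdd' : d * d⁻¹ = 1 := Matrix.mul_nonsing_inv _ (isUnit_iff_ne_zero.2 hd)
  -- A chart direction also moves the leading blocks `c`, `d` of the twist; `ψ` records this as a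
  -- row operation, again through a shear.
  let ψ : (Coords k n × Coords l n) →ₗ[ℝ]
      (Matrix (Fin k) (Fin k) ℝ × Matrix (Fin l) (Fin l) ℝ) :=
    { toFun := fun e => (-(γ e * c⁻¹)ᵀ, -(δ e * d⁻¹)ᵀ)
      map_add' := fun e e' => by
        simp [Matrix.add_mul, add_comm]
      map_smul' := fun a e => by simp }
  -- The sign of `L` comes from the minus sign in the differentiated relations. On row operations,
  -- ⟨y, Z x⟩ = ⟨Zᵀ y, x⟩, and `Zᵀ * c = c * (c⁻¹ * Zᵀ * c)`.
  let G := (-L).prodMap ((conjTranspose c c⁻¹).prodMap (conjTranspose d d⁻¹))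
  let ρ := blocksEquiv hk hl
  -- This is the differentiated system of relations, as an equality of endomorphisms of the space of
  -- all matrices.
  have key : pairRight y ∘ₗ (ρ.toLinearMap ∘ₗ shear (mulCoordsMap p) ∘ₗ ρ.symm.toLinearMap) =
      pairLeft (colExt k (chartStack p)) ∘ₗ mulCols (blockDiag c d) ∘ₗ
        (ρ.toLinearMap ∘ₗ (shear (mulCoordsMap q) ∘ₗ G ∘ₗ shearSnd ψ) ∘ₗ
          ρ.symm.toLinearMap) := by
    refine LinearMap.ext fun X => ?_
    obtain ⟨⟨e, Z⟩, rfl⟩ := ρ.surjective X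
    simp only [LinearMap.comp_apply, LinearEquiv.coe_coe, LinearEquiv.symm_apply_apply]
    funext a s
    rw [pairRight_apply, pairLeft_apply, of_blocksEquiv_transpose, mulCols_apply,
      blocksEquiv_apply]
    set b : ℤ := (a : ℤ) + 1 - l + ((finSumFinEquiv s : Fin (k + l)) : ℤ)
    have hL : stack (joinBlocks (shear (mulCoordsMap p) (e, Z)).2.1
        (shear (mulCoordsMap p) (e, Z)).1.1) (joinBlocks (shear (mulCoordsMap p) (e, Z)).2.2
        (shear (mulCoordsMap p) (e, Z)).1.2) =
        stack (Z.1 * chartMatrix p.1 + joinBlocks 0 e.1)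
          (Z.2 * chartMatrix p.2 + joinBlocks 0 e.2) :=
      congrArg₂ stack (joinBlocks_add_mulCoords _ _ _) (joinBlocks_add_mulCoords _ _ _)
    have hR : stack (joinBlocks (shear (mulCoordsMap q) (G (shearSnd ψ (e, Z)))).2.1
        (shear (mulCoordsMap q) (G (shearSnd ψ (e, Z)))).1.1)
        (joinBlocks (shear (mulCoordsMap q) (G (shearSnd ψ (e, Z)))).2.2
        (shear (mulCoordsMap q) (G (shearSnd ψ (e, Z)))).1.2) =
        stack (c⁻¹ * (Z.1 + -(γ e * c⁻¹)ᵀ)ᵀ * c * chartMatrix q.1 + joinBlocks 0 (-(L e).1))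
          (d⁻¹ * (Z.2 + -(δ e * d⁻¹)ᵀ)ᵀ * d * chartMatrix q.2 + joinBlocks 0 (-(L e).2)) :=
      congrArg₂ stack (joinBlocks_add_mulCoords _ _ _) (joinBlocks_add_mulCoords _ _ _)
    rw [hL, hR, colExt_stack_add, colExt_stack_mul, dotProduct_add]
    have hvec : ∀ {r : ℕ} (m z g : Matrix (Fin r) (Fin r) ℝ) (A A' : Coords r n), m * m⁻¹ = 1 →
        m⁻¹ * m = 1 → m * (m⁻¹ * (z + -(g * m⁻¹)ᵀ)ᵀ * m * chartMatrix A + joinBlocks 0 (-A')) =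
          zᵀ * (m * chartMatrix A) - (g * chartMatrix A + m * joinBlocks 0 A') := by
      intro r m z g A A' hm hm'
      have h3 : m * (m⁻¹ * (z + -(g * m⁻¹)ᵀ)ᵀ * m) = zᵀ * m - g := by
        rw [Matrix.transpose_add, Matrix.transpose_neg, Matrix.transpose_transpose, ← Matrix.mul_assoc,
          ← Matrix.mul_assoc, hm, Matrix.one_mul, Matrix.add_mul, Matrix.neg_mul, Matrix.mul_assoc g,
          hm', Matrix.mul_one, sub_eq_add_neg]
      rw [Matrix.mul_add, ← Matrix.mul_assoc, h3, joinBlocks_zero_neg, Matrix.mul_neg,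
        Matrix.sub_mul, Matrix.mul_assoc]
      abel
    have hcol : blockDiag c d *ᵥ
        (stack (c⁻¹ * (Z.1 + -(γ e * c⁻¹)ᵀ)ᵀ * c * chartMatrix q.1 + joinBlocks 0 (-(L e).1))
          (d⁻¹ * (Z.2 + -(δ e * d⁻¹)ᵀ)ᵀ * d * chartMatrix q.2 + joinBlocks 0 (-(L e).2)))ᵀ a =
        (blockDiag Z.1 Z.2)ᵀ *ᵥ y ((a : ℤ) + 1) -
          (stack (γ e * chartMatrix q.1 + c * joinBlocks 0 (L e).1)
            (δ e * chartMatrix q.2 + d * joinBlocks 0 (L e).2))ᵀ a := by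
      rw [hy]
      ext (i | i)
      · have := congrFun (congrFun (hvec c Z.1 (γ e) q.1 (L e).1 hcc' hcc) i) a
        rw [Matrix.mul_apply, Matrix.sub_apply, Matrix.mul_apply] at this
        simpa [Matrix.mulVec, dotProduct] using this
      · have := congrFun (congrFun (hvec d Z.2 (δ e) q.2 (L e).2 hdd' hdd) i) a
        rw [Matrix.mul_apply, Matrix.sub_apply, Matrix.mul_apply] at this
        simpa [Matrix.mulVec, dotProduct] using this
    rw [hcol, sub_dotProduct, Matrix.mulVec_transpose, ← Matrix.dotProduct_mulVec]
    exact eq_sub_of_add_eq' (by rw [add_left_comm, hband e a s, add_zero]; rfl)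
  -- All shears and the conjugation by `ρ` drop out of the determinants.
  have hdet := congrArg LinearMap.det key
  have hC : (blockDiag c d).det = c.det * d.det := Matrix.det_fromBlocks_zero₂₁ _ _ _
  have hG : LinearMap.det G = (-1) ^ Module.finrank ℝ (Coords k n × Coords l n) *
      LinearMap.det L * (ε₁ * ε₂) := by
    rw [LinearMap.det_prodMap, LinearMap.det_prodMap, h₁ c c⁻¹ hcc, h₂ d d⁻¹ hdd,
      ← neg_one_smul ℝ L, LinearMap.det_smul]
  rw [LinearMap.det_comp, LinearMap.det_conj, det_shear, mul_one, LinearMap.det_comp,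
    LinearMap.det_comp, LinearMap.det_conj, LinearMap.det_comp, LinearMap.det_comp, det_shear,
    det_shearSnd, det_mulCols, hC, hG] at hdet
  rw [hdet]
  push_cast
  ring

end Blocks

/-! ### Differentiability of the stacked twist -/

section Derivative

variable {E : Type} [NormedAddCommGroup E] [NormedSpace ℝ E]

theorem analyticAt_inv_apply {ι : Type} [Fintype ι] [DecidableEq ι] {M : E → Matrix ι ι ℝ} {p : E}
    (h : ∀ i j, AnalyticAt ℝ (fun q => M q i j) p) (hp : (M p).det ≠ 0) (i j : ι) :
    AnalyticAt ℝ (fun q => (M q)⁻¹ i j) p := by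
  simp only [Matrix.inv_def, Ring.inverse_eq_inv', Matrix.smul_apply, smul_eq_mul,
    Matrix.adjugate_apply]
  refine ((analyticAt_det h).inv hp).mul (analyticAt_det fun r s => ?_)
  by_cases hr : r = j
  · subst hr
    simp only [Matrix.updateRow_self]
    exact analyticAt_const
  · simp only [Matrix.updateRow_ne hr]
    exact h r s

variable {k l n : ℕ} [NeZero n]

/-- The columns of the window ending at `j + k - 1`, as rows. -/
def windowRows (U : Matrix (Fin k ⊕ Fin l) (Fin n) ℝ) (j : ℤ) :
    Matrix (Fin k ⊕ Fin l) (Fin k ⊕ Fin l) ℝ :=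
  Matrix.of fun s r => colExt k U (j - l + ((finSumFinEquiv s : Fin (k + l)) : ℤ)) r

theorem det_windowRows (U : Matrix (Fin k ⊕ Fin l) (Fin n) ℝ) (j : ℤ) :
    (windowRows U j).det = windowDet finSumFinEquiv.symm (colExt k U) (j - l) := by
  rw [windowDet, ← Matrix.det_submatrix_equiv_self finSumFinEquiv, ← Matrix.det_transpose]
  congr 1
  ext r s
  simp [windowRows]

/-- This replaces the choice in `twistCol` by an explicit inverse matrix, so that Cramer's rule
gives analyticity. -/
theorem twistCol_eq_mulVec {U : Matrix (Fin k ⊕ Fin l) (Fin n) ℝ} (hU : InMatCirc U) (j : ℤ) :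
    twistCol U j = (windowRows U j)⁻¹ *ᵥ
      fun s => if ((finSumFinEquiv s : Fin (k + l)) : ℕ) = 0 then (-1 : ℝ) ^ j else 0 := by
  have hdet : IsUnit (windowRows U j).det := by
    rw [det_windowRows, isUnit_iff_ne_zero]
    exact (inMatCirc_iff U).1 hU _
  have h1 : (windowRows U j) *ᵥ twistCol U j =
      fun s => if ((finSumFinEquiv s : Fin (k + l)) : ℕ) = 0 then (-1 : ℝ) ^ j else 0 := by
    funext s
    rw [← isTwistCol_twistCol hU j (finSumFinEquiv s), dotProduct_comm]
    rfl
  rw [← h1, Matrix.mulVec_mulVec, Matrix.nonsing_inv_mul _ hdet, Matrix.one_mulVec]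

/-- The preimage of the good locus in the charts. -/
abbrev coordLocus (k l n : ℕ) [NeZero n] : Set (Coords k n × Coords l n) := {p | locusFun p ≠ 0}

theorem isOpen_coordLocus : IsOpen (coordLocus k l n) :=
  isOpen_ne_fun (continuous_iff_continuousAt.2 fun p => (analyticAt_locusFun p).continuousAt)
    continuous_const

theorem inMatCirc_of_mem {p : Coords k n × Coords l n} (hp : p ∈ coordLocus k l n) :
    InMatCirc (chartStack p) :=
  (windowProd_ne_zero_iff _).1 (left_ne_zero_of_mul hp)

/-- The explicit formula is valid on the locus, which is open, so it determines the germ at `p`. -/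
theorem analyticAt_twistCol {p : Coords k n × Coords l n} (hp : p ∈ coordLocus k l n) (j : ℤ)
    (a : Fin k ⊕ Fin l) :
    AnalyticAt ℝ (fun q : Coords k n × Coords l n => twistCol (chartStack q) j a) p := by
  have h : (fun q : Coords k n × Coords l n => ((windowRows (chartStack q) j)⁻¹ *ᵥ
      fun s => if ((finSumFinEquiv s : Fin (k + l)) : ℕ) = 0 then (-1 : ℝ) ^ j else 0) a) =ᶠ[𝓝 p]
      fun q => twistCol (chartStack q) j a := by
    filter_upwards [isOpen_coordLocus.mem_nhds hp] with q hq
    rw [twistCol_eq_mulVec (inMatCirc_of_mem hq)]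
  refine AnalyticAt.congr ?_ h
  simp only [Matrix.mulVec, dotProduct]
  refine Finset.analyticAt_fun_sum _ fun s _ => AnalyticAt.mul ?_ analyticAt_const
  refine analyticAt_inv_apply (fun s r => ?_) ?_ a s
  · simp only [windowRows, Matrix.of_apply, colExt_eq]
    exact analyticAt_const.mul (analyticAt_chartStack p _ _)
  · rw [det_windowRows]
    exact (inMatCirc_iff _).1 (inMatCirc_of_mem hp) _

/-- The stacked twist in the charts, as a pair of matrices. -/
def twistMat (p : Coords k n × Coords l n) : Matrix (Fin k) (Fin n) ℝ × Matrix (Fin l) (Fin n) ℝ :=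
  stwMat (chartMatrix p.1) (chartMatrix p.2)

/-- The leading square block of a matrix. -/
def leadingBlock {r n : ℕ} (hr : r ≤ n) (X : Matrix (Fin r) (Fin n) ℝ) :
    Matrix (Fin r) (Fin r) ℝ := X.submatrix id (Fin.castLE hr)

theorem eq_leadingBlock_mul {r n : ℕ} (hr : r ≤ n) {X : Matrix (Fin r) (Fin n) ℝ} {Y : Gr r n}
    {A : Coords r n} (hX : rowSpan X = Y.1) (hA : chart hr A = Y) :
    X = leadingBlock hr X * chartMatrix A := by
  obtain ⟨g, -, -, rfl⟩ := exists_mul_eq (congrArg Subtype.val hA) hX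
  congr 1
  ext i j
  exact (vecMul_chartMatrix hr A (g i) j).symm

variable (hk : k ≤ n) (hl : l ≤ n)

theorem twistMat_eq (hkl : k + l ≤ n) {p : Coords k n × Coords l n} (hp : p ∈ coordLocus k l n) :
    (twistMat p).1 = leadingBlock hk (twistMat p).1 * chartMatrix (stwCoord hk hl p).1 ∧
      (twistMat p).2 = leadingBlock hl (twistMat p).2 * chartMatrix (stwCoord hk hl p).2 := by
  rw [coordLocus, ← preimage_goodLocus hk hl, Set.mem_preimage] at hp
  have h1 := isStw_stw hkl hp.1 (chartMatrix p.1) (chartMatrix p.2) rfl rfl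
  have h2 := mapsTo_stw hkl hp
  exact ⟨eq_leadingBlock_mul hk h1.1 (chart_coord hk h2.1),
    eq_leadingBlock_mul hl h1.2 (chart_coord hl h2.2)⟩

/-- A singular leading block would kill every circular minor of that half of the twist, against the
complementary minor identities. -/
theorem det_leadingBlock_ne_zero (hkl : k + l ≤ n) {p : Coords k n × Coords l n}
    (hp : p ∈ coordLocus k l n) : (leadingBlock hk (twistMat p).1).det ≠ 0 ∧
      (leadingBlock hl (twistMat p).2).det ≠ 0 := by
  have hU := inMatCirc_of_mem hp
  have hV := left_ne_zero_of_mul (right_ne_zero_of_mul hp)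
  have hW := right_ne_zero_of_mul (right_ne_zero_of_mul hp)
  obtain ⟨h1, h2⟩ := twistMat_eq hk hl hkl hp
  obtain ⟨ε, hε⟩ := circProd_stwMat_fst k l n
  obtain ⟨δ, hδ⟩ := circProd_stwMat_snd k l n
  have h3 : circProd (twistMat p).1 * _ = _ := hε _ _ hU
  have h4 : circProd (twistMat p).2 * _ = _ := hδ _ _ hU
  constructor
  · intro h
    rw [h1, circProd_mul, h, zero_pow (NeZero.ne n), zero_mul, zero_mul] at h3
    exact mul_ne_zero (by simp) hW h3.symm
  · intro h
    rw [h2, circProd_mul, h, zero_pow (NeZero.ne n), zero_mul, zero_mul] at h4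
    exact mul_ne_zero (by simp) hV h4.symm

theorem analyticAt_twistMat_fst {p : Coords k n × Coords l n} (hp : p ∈ coordLocus k l n)
    (i : Fin k) (j : Fin n) :
    AnalyticAt ℝ (fun q : Coords k n × Coords l n => (twistMat q).1 i j) p :=
  analyticAt_twistCol hp _ _

theorem analyticAt_twistMat_snd {p : Coords k n × Coords l n} (hp : p ∈ coordLocus k l n)
    (i : Fin l) (j : Fin n) :
    AnalyticAt ℝ (fun q : Coords k n × Coords l n => (twistMat q).2 i j) p :=
  analyticAt_twistCol hp _ _

/-- Near `p`, the coordinates are the last columns of the inverse leading block times `X`, hence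
analytic. -/
theorem differentiableAt_coords {r n : ℕ} (hr : r ≤ n) {X : E → Matrix (Fin r) (Fin n) ℝ}
    {A : E → Coords r n} {p : E} (hX : ∀ i j, AnalyticAt ℝ (fun q => X q i j) p)
    (hdet : (leadingBlock hr (X p)).det ≠ 0)
    (hA : ∀ᶠ q in 𝓝 p, (leadingBlock hr (X q)).det ≠ 0 ∧
      X q = leadingBlock hr (X q) * chartMatrix (A q)) : DifferentiableAt ℝ A p := by
  refine differentiableAt_pi.2 fun i => differentiableAt_pi.2 fun j => ?_
  have hj : r + (j : ℕ) < n := by have := j.2; omega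
  have h : (fun q => ∑ s, (leadingBlock hr (X q))⁻¹ i s * X q s ⟨r + j, hj⟩) =ᶠ[𝓝 p]
      fun q => A q i j := by
    filter_upwards [hA] with q hq
    have h1 : (leadingBlock hr (X q))⁻¹ * X q = chartMatrix (A q) := by
      conv_lhs => rw [hq.2]
      rw [← Matrix.mul_assoc]
      rw [← hq.2, Matrix.nonsing_inv_mul _ (isUnit_iff_ne_zero.2 hq.1), Matrix.one_mul]
    rw [← Matrix.mul_apply, h1]
    simp [chartMatrix]
  refine (AnalyticAt.congr ?_ h).differentiableAt
  exact Finset.analyticAt_fun_sum _ fun s _ =>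
    (analyticAt_inv_apply (fun _ _ => hX _ _) hdet i s).mul (hX _ _)

theorem differentiableAt_stwCoord (hkl : k + l ≤ n) {p : Coords k n × Coords l n}
    (hp : p ∈ coordLocus k l n) : DifferentiableAt ℝ (stwCoord hk hl) p := by
  have hev := isOpen_coordLocus.mem_nhds hp
  refine DifferentiableAt.prodMk (f₁ := fun q => (stwCoord hk hl q).1)
    (f₂ := fun q => (stwCoord hk hl q).2) ?_ ?_
  · refine differentiableAt_coords hk (X := fun q => (twistMat q).1)
      (analyticAt_twistMat_fst hp) (det_leadingBlock_ne_zero hk hl hkl hp).1 ?_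
    filter_upwards [hev] with q hq
    exact ⟨(det_leadingBlock_ne_zero hk hl hkl hq).1, (twistMat_eq hk hl hkl hq).1⟩
  · refine differentiableAt_coords hl (X := fun q => (twistMat q).2)
      (analyticAt_twistMat_snd hp) (det_leadingBlock_ne_zero hk hl hkl hp).2 ?_
    filter_upwards [hev] with q hq
    exact ⟨(det_leadingBlock_ne_zero hk hl hkl hq).2, (twistMat_eq hk hl hkl hq).2⟩

theorem hasLineDerivAt_chartMatrix {r n : ℕ} {A : E → Coords r n} {p e : E} {A' : Coords r n}
    (hA : ∀ i j, HasLineDerivAt ℝ (fun q => A q i j) (A' i j) p e) (i : Fin r) (j : Fin n) :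
    HasLineDerivAt ℝ (fun q => chartMatrix (A q) i j)
      (joinBlocks (0 : Matrix (Fin r) (Fin r) ℝ) A' i j) p e := by
  simp only [chartMatrix, joinBlocks, Matrix.of_apply]
  split_ifs
  · exact hasDerivAt_const _ _
  · exact hasDerivAt_const _ _
  · exact hA _ _

theorem hasLineDerivAt_sum_mul {ι : Type} [Fintype ι] {f g : ι → E → ℝ} {f' g' : ι → ℝ} {p e : E}
    (hf : ∀ i, HasLineDerivAt ℝ (f i) (f' i) p e) (hg : ∀ i, HasLineDerivAt ℝ (g i) (g' i) p e) :
    HasLineDerivAt ℝ (fun q => ∑ i, f i q * g i q) (∑ i, (f' i * g i p + f i p * g' i)) p e := by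
  have h := HasDerivAt.fun_sum (u := Finset.univ) fun i _ => (hf i).mul (hg i)
  simpa [HasLineDerivAt] using h

/-- By the Leibniz rule, the motion of the leading block gives a row operation term and the motion
of the coordinates a chart term, which is the shape required by `det_pairRight_eq`. -/
theorem hasLineDerivAt_leadingBlock_mul {r n : ℕ} (hr : r ≤ n) {X : E → Matrix (Fin r) (Fin n) ℝ}
    {A : E → Coords r n} {p e : E} (hX : ∀ i j, DifferentiableAt ℝ (fun q => X q i j) p)
    (hA : DifferentiableAt ℝ A p)
    (hXA : ∀ᶠ q in 𝓝 p, X q = leadingBlock hr (X q) * chartMatrix (A q)) (i : Fin r) (j : Fin n) :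
    HasLineDerivAt ℝ (fun q => X q i j)
      (((Matrix.of fun i j => fderiv ℝ (fun q => X q i (Fin.castLE hr j)) p e) * chartMatrix (A p) +
        leadingBlock hr (X p) * joinBlocks 0 (fderiv ℝ A p e)) i j) p e := by
  have hA' : ∀ i j, HasLineDerivAt ℝ (fun q => A q i j) (fderiv ℝ A p e i j) p e := by
    intro i j
    have h1 := hA.hasFDerivAt
    rw [hasFDerivAt_pi'] at h1
    have h2 := h1 i
    rw [hasFDerivAt_pi'] at h2
    exact (h2 j).hasLineDerivAt e
  have h := hasLineDerivAt_sum_mul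
    (f := fun s q => leadingBlock hr (X q) i s) (g := fun s q => chartMatrix (A q) s j)
    (fun s => (hX i (Fin.castLE hr s)).hasFDerivAt.hasLineDerivAt e)
    (fun s => hasLineDerivAt_chartMatrix hA' s j)
  rw [Finset.sum_add_distrib] at h
  refine HasLineDerivAt.congr_of_eventuallyEq h ?_
  filter_upwards [hXA] with q hq
  rw [← Matrix.mul_apply, ← hq]

theorem hasLineDerivAt_colExt_chartStack (p e : Coords k n × Coords l n) (j : ℤ)
    (r : Fin k ⊕ Fin l) :
    HasLineDerivAt ℝ (fun q : Coords k n × Coords l n => colExt k (chartStack q) j r)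
      (colExt k (stack (joinBlocks 0 e.1) (joinBlocks 0 e.2)) j r) p e := by
  simp only [colExt_eq]
  refine HasDerivAt.const_mul _ ?_
  rcases r with r | r
  · refine hasLineDerivAt_chartMatrix (A := fun q : Coords k n × Coords l n => q.1)
      (fun i j => ?_) r _
    have h := ((ContinuousLinearMap.proj (R := ℝ) (φ := fun _ : Fin (n - k) => ℝ) j).comp
      ((ContinuousLinearMap.proj (R := ℝ) (φ := fun _ : Fin k => Fin (n - k) → ℝ) i).comp
        (ContinuousLinearMap.fst ℝ (Coords k n) (Coords l n)))).hasFDerivAt (x := p)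
    exact h.hasLineDerivAt e
  · refine hasLineDerivAt_chartMatrix (A := fun q : Coords k n × Coords l n => q.2)
      (fun i j => ?_) r _
    have h := ((ContinuousLinearMap.proj (R := ℝ) (φ := fun _ : Fin (n - l) => ℝ) j).comp
      ((ContinuousLinearMap.proj (R := ℝ) (φ := fun _ : Fin l => Fin (n - l) → ℝ) i).comp
        (ContinuousLinearMap.snd ℝ (Coords k n) (Coords l n)))).hasFDerivAt (x := p)
    exact h.hasLineDerivAt e

/-- The derivative of the defining relations of the twist. -/
theorem band_relation {p : Coords k n × Coords l n} (hp : p ∈ coordLocus k l n)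
    {e : Coords k n × Coords l n} {a : ℤ} {v : Fin k ⊕ Fin l → ℝ}
    (hv : ∀ r, HasLineDerivAt ℝ (fun q : Coords k n × Coords l n => twistCol (chartStack q) a r)
      (v r) p e) (s : Fin k ⊕ Fin l) :
    v ⬝ᵥ colExt k (chartStack p) (a - l + ((finSumFinEquiv s : Fin (k + l)) : ℤ)) +
      twistCol (chartStack p) a ⬝ᵥ colExt k (stack (joinBlocks 0 e.1) (joinBlocks 0 e.2))
        (a - l + ((finSumFinEquiv s : Fin (k + l)) : ℤ)) = 0 := by
  have h1 := hasLineDerivAt_sum_mul hv fun r => hasLineDerivAt_colExt_chartStack p e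
    (a - l + ((finSumFinEquiv s : Fin (k + l)) : ℤ)) r
  have h2 : HasLineDerivAt ℝ (fun q : Coords k n × Coords l n => ∑ r,
      twistCol (chartStack q) a r *
        colExt k (chartStack q) (a - l + ((finSumFinEquiv s : Fin (k + l)) : ℤ)) r) 0 p e := by
    refine HasLineDerivAt.congr_of_eventuallyEq (f := fun _ => if
      ((finSumFinEquiv s : Fin (k + l)) : ℕ) = 0 then (-1 : ℝ) ^ a else 0)
      (hasDerivAt_const _ _) ?_
    filter_upwards [isOpen_coordLocus.mem_nhds hp] with q hq
    exact isTwistCol_twistCol (inMatCirc_of_mem hq) a (finSumFinEquiv s)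
  have h3 := HasDerivAt.unique h1 h2
  rw [Finset.sum_add_distrib] at h3
  exact h3

/-- The derivative of the leading block of a matrix valued map. -/
def leadingDeriv {r n : ℕ} (hr : r ≤ n) (X : E → Matrix (Fin r) (Fin n) ℝ) (p : E) :
    E →ₗ[ℝ] Matrix (Fin r) (Fin r) ℝ where
  toFun e := Matrix.of fun i j => fderiv ℝ (fun q => X q i (Fin.castLE hr j)) p e
  map_add' e e' := by ext i j; simp
  map_smul' c e := by ext i j; simp

/-- The Jacobian determinant of the stacked twist in the charts. -/
theorem det_fderiv_stwCoord (k l n : ℕ) [NeZero n] (hk : k ≤ n) (hl : l ≤ n) (hkl : k + l ≤ n) :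
    ∃ ε : ℤˣ, ∀ p ∈ coordLocus k l n,
      windowProd (chartStack p) ^ 2 *
        ((leadingBlock hk (twistMat p).1).det * (leadingBlock hl (twistMat p).2).det) ^ n *
          LinearMap.det (fderiv ℝ (stwCoord hk hl) p).toLinearMap = ((ε : ℤ) : ℝ) := by
  obtain ⟨ε₁, h₁⟩ := det_pairRight_eq k l n hk hl
  obtain ⟨ε₂, h₂⟩ := det_pairRight k l n (Int.negOnePow ((n : ℤ) + ((k : ℤ) - 1)))
  obtain ⟨ε₃, h₃⟩ := prod_windowDet_twistCol k l n (2 - k)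
  obtain ⟨ε₄, h₄⟩ := prod_windowDet_shift (n := n) (finSumFinEquiv (m := k) (n := l)).symm
    (Int.negOnePow ((k : ℤ) - 1)) (1 - l)
  refine ⟨ε₁ * ε₂ * ε₃ * ε₄, fun p hp => ?_⟩
  have hU := inMatCirc_of_mem hp
  have hev := isOpen_coordLocus.mem_nhds hp
  have hdiff := differentiableAt_stwCoord hk hl hkl hp
  obtain ⟨hc, hd⟩ := det_leadingBlock_ne_zero hk hl hkl hp
  obtain ⟨hW, hV⟩ := twistMat_eq hk hl hkl hp
  have hdV : ∀ (e : Coords k n × Coords l n) (a : Fin n) (r : Fin k ⊕ Fin l), HasLineDerivAt ℝ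
      (fun q : Coords k n × Coords l n => twistCol (chartStack q) ((a : ℤ) + 1) r)
      ((stack (leadingDeriv hk (fun q => (twistMat q).1) p e * chartMatrix (stwCoord hk hl p).1 +
          leadingBlock hk (twistMat p).1 * joinBlocks 0 (fderiv ℝ (stwCoord hk hl) p e).1)
        (leadingDeriv hl (fun q => (twistMat q).2) p e * chartMatrix (stwCoord hk hl p).2 +
          leadingBlock hl (twistMat p).2 * joinBlocks 0 (fderiv ℝ (stwCoord hk hl) p e).2))ᵀ a r)
      p e := by
    intro e a r
    rcases r with r | r
    · have h := hasLineDerivAt_leadingBlock_mul (e := e) hk (X := fun q => (twistMat q).1)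
        (A := fun q => (stwCoord hk hl q).1)
        (fun i j => (analyticAt_twistMat_fst hp i j).differentiableAt) hdiff.fst
        (by filter_upwards [hev] with q hq; exact (twistMat_eq hk hl hkl hq).1) r a
      rw [fderiv.fst hdiff] at h
      exact h
    · have h := hasLineDerivAt_leadingBlock_mul (e := e) hl (X := fun q => (twistMat q).2)
        (A := fun q => (stwCoord hk hl q).2)
        (fun i j => (analyticAt_twistMat_snd hp i j).differentiableAt) hdiff.snd
        (by filter_upwards [hev] with q hq; exact (twistMat_eq hk hl hkl hq).2) r a
      rw [fderiv.snd hdiff] at h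
      exact h
  have h5 := h₁ p (stwCoord hk hl p) (twistCol (chartStack p)) (leadingBlock hk (twistMat p).1)
    (leadingBlock hl (twistMat p).2) (fderiv ℝ (stwCoord hk hl) p).toLinearMap
    (leadingDeriv hk (fun q => (twistMat q).1) p) (leadingDeriv hl (fun q => (twistMat q).2) p)
    hc hd ?_ ?_
  -- Here the right pairing becomes ± the product `T` of windows of the twist, and the left one
  -- becomes ±P. With T · P = ±1, multiplying by P produces the square.
  · rw [h₂ _ (twistCol_add_period hU), det_pairLeft, h₄ _ (colExt_add_period k _)] at h5
    have h6 := h₃ _ hU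
    have h7 : windowProd (chartStack p) = ∏ i : Fin n, windowDet finSumFinEquiv.symm
      (colExt k (chartStack p)) (i : ℤ) := rfl
    rw [← h7] at h5
    push_cast
    have e1 := unit_cast_mul_self ε₁
    have e4 := unit_cast_mul_self ε₄
    set P := windowProd (chartStack p)
    set J := LinearMap.det (fderiv ℝ (stwCoord hk hl) p).toLinearMap
    set m := ((leadingBlock hk (twistMat p).1).det * (leadingBlock hl (twistMat p).2).det) ^ n
    set T := ∏ a : Fin n, windowDet finSumFinEquiv.symm (twistCol (chartStack p))
      ((a : ℤ) + (2 - k))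
    rw [← h6]
    linear_combination (-((ε₁ : ℤ) : ℝ) * ε₄ * P) * h5 - P ^ 2 * m * J * e1 * (ε₄ * ε₄ : ℝ) -
      P ^ 2 * m * J * e4
  · intro b
    rw [← hW, ← hV]
    ext (i | i) <;> rfl
  · intro e a s
    exact band_relation hp (hdV e a) s

end Derivative

/-! ### Pulling back top forms -/

section TopForm

/-- Forms of top degree are multiples of the determinant in a basis. -/
theorem compLinearMap_eq_det_smul {E ι : Type} [AddCommGroup E] [Module ℝ E] [Fintype ι]
    [DecidableEq ι] (b : Module.Basis ι ℝ E) (ω : E [⋀^ι]→ₗ[ℝ] ℝ) (L : E →ₗ[ℝ] E) :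
    ω.compLinearMap L = LinearMap.det L • ω := by
  ext v
  have h : ω = ω b • b.det := ω.eq_smul_basis_det b
  rw [h]
  have h2 := b.det_comp L v
  simp only [AlternatingMap.compLinearMap_apply, AlternatingMap.smul_apply, smul_eq_mul]
  rw [show (fun i => L (v i)) = ⇑L ∘ v from rfl, h2]
  ring

theorem wedge_smul_smul {E ι κ : Type} [AddCommGroup E] [Module ℝ E] [Fintype ι] [Fintype κ]
    [DecidableEq ι] [DecidableEq κ] (a b : ℝ) (α : E [⋀^ι]→ₗ[ℝ] ℝ) (β : E [⋀^κ]→ₗ[ℝ] ℝ) :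
    wedge (a • α) (b • β) = (a * b) • wedge α β := by
  rw [wedge, wedge, ← AlternatingMap.domCoprod'_apply, ← AlternatingMap.domCoprod'_apply,
    TensorProduct.smul_tmul_smul, map_smul]
  ext v
  simp

/-- The basis of the coordinate vectors. -/
def coordsBasis (k n : ℕ) : Module.Basis (Fin k × Fin (n - k)) ℝ (Coords k n) :=
  (Pi.basisFun ℝ (Fin k × Fin (n - k))).map (LinearEquiv.curry ℝ ℝ (Fin k) (Fin (n - k)))

variable {k l n : ℕ} [NeZero n]

/-- The constant form of top degree. -/
def volumeForm (k l n : ℕ) :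
    (Coords k n × Coords l n) [⋀^(Fin k × Fin (n - k)) ⊕ (Fin l × Fin (n - l))]→ₗ[ℝ] ℝ :=
  wedge ((coordVolume k n).compLinearMap (LinearMap.fst ℝ (Coords k n) (Coords l n)))
    ((coordVolume l n).compLinearMap (LinearMap.snd ℝ (Coords k n) (Coords l n)))

theorem topForm_eq (p : Coords k n × Coords l n) :
    topForm k l n p =
      ((circProd (chartMatrix p.1))⁻¹ * (circProd (chartMatrix p.2))⁻¹) • volumeForm k l n := by
  rw [volumeForm, ← wedge_smul_smul]
  rfl

theorem pullback_topForm (φ : Coords k n × Coords l n → Coords k n × Coords l n)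
    (p : Coords k n × Coords l n) :
    pullback φ (topForm k l n) p =
      ((circProd (chartMatrix (φ p).1))⁻¹ * (circProd (chartMatrix (φ p).2))⁻¹ *
        LinearMap.det (fderiv ℝ φ p).toLinearMap) • volumeForm k l n := by
  rw [pullback, compLinearMap_eq_det_smul ((coordsBasis k n).prod (coordsBasis l n)), topForm_eq,
    smul_smul, mul_comm]

/-- Both forms are multiples of the constant volume form, so only the Jacobian has to be compared
with the circular products at the source and at the image. -/
theorem exists_pullback_stwCoord_eq (k l n : ℕ) [NeZero n] (hk : k ≤ n) (hl : l ≤ n)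
    (hkl : k + l ≤ n) : ∃ ε : ℝ, (ε = 1 ∨ ε = -1) ∧ ∀ p ∈ coordLocus k l n,
      pullback (stwCoord hk hl) (topForm k l n) p = ε • topForm k l n p := by
  obtain ⟨ε₁, h₁⟩ := det_fderiv_stwCoord k l n hk hl hkl
  obtain ⟨ε₂, h₂⟩ := circProd_stwMat_fst k l n
  obtain ⟨ε₃, h₃⟩ := circProd_stwMat_snd k l n
  refine ⟨((ε₁ * ε₂ * ε₃ : ℤˣ) : ℤ), ?_, fun p hp => ?_⟩
  · rcases Int.units_eq_one_or (ε₁ * ε₂ * ε₃) with h | h <;> simp [h]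
  have hU := inMatCirc_of_mem hp
  have hP : windowProd (chartStack p) ≠ 0 := left_ne_zero_of_mul hp
  have hV := left_ne_zero_of_mul (right_ne_zero_of_mul hp)
  have hW := right_ne_zero_of_mul (right_ne_zero_of_mul hp)
  obtain ⟨hc, hd⟩ := det_leadingBlock_ne_zero hk hl hkl hp
  obtain ⟨h4, h5⟩ := twistMat_eq hk hl hkl hp
  have h6 : circProd (twistMat p).1 * windowProd (chartStack p) = _ := h₂ _ _ hU
  have h7 : circProd (twistMat p).2 * windowProd (chartStack p) = _ := h₃ _ _ hU
  rw [h4, circProd_mul] at h6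
  rw [h5, circProd_mul] at h7
  have h8 := h₁ p hp
  rw [pullback_topForm, topForm_eq, smul_smul]
  congr 1
  have hA : circProd (chartMatrix (stwCoord hk hl p).1) ≠ 0 := by
    intro h
    rw [h, mul_zero, zero_mul] at h6
    exact mul_ne_zero (by simp) hW h6.symm
  have hB : circProd (chartMatrix (stwCoord hk hl p).2) ≠ 0 := by
    intro h
    rw [h, mul_zero, zero_mul] at h7
    exact mul_ne_zero (by simp) hV h7.symm
  have e2 := unit_cast_mul_self ε₂
  have e3 := unit_cast_mul_self ε₃
  push_cast
  set P := windowProd (chartStack p)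
  set J := LinearMap.det (fderiv ℝ (stwCoord hk hl) p).toLinearMap
  set a := circProd (chartMatrix (stwCoord hk hl p).1)
  set b := circProd (chartMatrix (stwCoord hk hl p).2)
  set v := circProd (chartMatrix p.1)
  set w := circProd (chartMatrix p.2)
  set c := (leadingBlock hk (twistMat p).1).det
  set d := (leadingBlock hl (twistMat p).2).det
  have hcd : P ^ 2 * (c * d) ^ n ≠ 0 := mul_ne_zero (pow_ne_zero _ hP)
    (pow_ne_zero _ (mul_ne_zero hc hd))
  -- The product of the two complementary minor identities carries the same factor `P ^ 2 * (c * d)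
  -- ^ n` as the Jacobian identity; cancelling it gives `h10`.
  have h9 : P ^ 2 * (c * d) ^ n * (a * b) = ε₂ * ε₃ * (v * w) := by
    rw [mul_pow]
    linear_combination d ^ n * b * P * h6 + ε₂ * w * h7
  have h10 : J * (v * w) = ε₁ * ε₂ * ε₃ * (a * b) := by
    apply mul_left_cancel₀ hcd
    linear_combination (v * w) * h8 - ε₁ * ε₂ * ε₃ * h9 -
      ε₁ * (v * w) * (ε₃ * ε₃ : ℝ) * e2 - ε₁ * (v * w) * e3
  field_simp
  linear_combination h10

end TopForm

end StackedTwist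

end

open StackedTwist
/-- The stacked twist map preserves the form `ω_{k,n} ∧ ω_{l,n}` up to one global sign. The
locus where the map is defined and the form is regular is open and dense, it lies in the chart
`[Id | A]`, and the map sends it to the locus where the form is regular. -/
theorem theorem5p4 (k l m n : ℕ) [NeZero n] (hm : Even m) (hn : k + l + m = n) :
    IsOpen (chartProd (by omega) (by omega) ⁻¹' goodLocus k l n) ∧
    Dense (chartProd (by omega) (by omega) ⁻¹' goodLocus k l n) ∧
    Set.MapsTo stw (goodLocus k l n) (regularLocus k n ×ˢ regularLocus l n) ∧
    ∃ ε : ℝ, (ε = 1 ∨ ε = -1) ∧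
      ∀ p ∈ chartProd (by omega) (by omega) ⁻¹' goodLocus k l n,
        DifferentiableAt ℝ (stwCoord (k := k) (l := l) (n := n) (by omega) (by omega)) p ∧
        pullback (stwCoord (by omega) (by omega)) (topForm k l n) p = ε • topForm k l n p := by
  have hkl : k + l ≤ n := by omega
  obtain ⟨ε, hε, h⟩ := exists_pullback_stwCoord_eq k l n (by omega) (by omega) hkl
  refine ⟨isOpen_preimage_goodLocus _ _, dense_preimage_goodLocus hkl _ _, mapsTo_stw hkl, ε, hε,
    fun p hp => ?_⟩
  rw [preimage_goodLocus] at hp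
  exact ⟨differentiableAt_stwCoord _ _ hkl hp, h p hp⟩
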